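/- Let $k\ge 1$ and let $\Lambda$ be a $k$-graph, that is, a countable small category with range and source maps $r,s$ and a degree functor $d:\Lambda\to\mathbb N^k$ with the unique factorization property; objects (vertices, $\Lambda^0$) are identified with identity morphisms, and $v\Lambda^n=\{\lambda\in\Lambda: r(\lambda)=v,\ d(\lambda)=n\}$. Assume that $\Lambda$ is row-finite (every $v\Lambda^n$ is finite), source-free (every $v\Lambda^n$ is nonempty) and has no sinks (for every vertex $v$ and every $1\le i\le k$ there is $\lambda\in\Lambda$ with $s(\lambda)=v$ and $d(\lambda)=e_i$). Let $\Lambda^\infty$ be the space of infinite paths, i.e. of degree-preserving functors $x:\Omega_k\to\Lambda$, where $\Omega_k$ has object set $\mathbb N^k$ and a unique morphism $(p,q)$, of degree $q-p$, with range $p$ and source $q$, for each $p\le q$. Give $\Lambda^\infty$ the topology generated by the cylinder sets $Z(\lambda)=\{x: x(0,d(\lambda))=\lambda\}$ and its Borel $\sigma$-algebra. The standard coding maps are the shifts $\sigma^n(x)(p,q)=x(p+n,q+n)$, and the standard prefixing maps are $\sigma_\lambda:Z(s(\lambda))\to Z(\lambda)$, $\sigma_\lambda(x)=\lambda x$. Let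 $\mu$ be a Radon measure on $\Lambda^\infty$ and let $\{f_\lambda\}_{\lambda\in\Lambda}\subseteq L^2(\Lambda^\infty,\mu)$ be such that the standard maps and the $f_\lambda$ form a $\Lambda$-projective system. This means the following. For every $m\in\mathbb N^k$ the maps $\{\sigma_\lambda: d(\lambda)=m\}$ form a semibranching function system with coding map $\sigma^m$: one has $0<\mu(Z(s(\lambda)))<\infty$ and $\mu(Z(\lambda))<\infty$, the sets $Z(\lambda)$ with $d(\lambda)=m$ are pairwise disjoint and cover $\Lambda^\infty$ up to null sets, and the Radon–Nikodym derivative $d(\mu\circ\sigma_\lambda)/d\mu$ exists and is strictly positive $\mu$-a.e. on $Z(s(\lambda))$. (The remaining axioms of a $\Lambda$-semibranching function system, namely $\sigma_v=\mathrm{id}$, $\sigma_\lambda\sigma_\nu=\sigma_{\lambda\nu}$ and $\sigma^m\sigma^n=\sigma^{m+n}$, hold for the standard maps.) Moreover $0\ne d(\mu\circ\sigma_\lambda^{-1})/d\mu=|f_\lambda|^2$ for every $\lambda\in\Lambda$, and $f_\lambda\cdot(f_\nu\circ\sigma^{d(\lambda)})=f_{\lambda\nu}$ $\mu$-a.e.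 whenever $s(\lambda)=r(\nu)$. Put $T_\lambda\xi=f_\lambda\cdot(\xi\circ\sigma^{d(\lambda)})$ for $\xi\in L^2(\Lambda^\infty,\mu)$; the $T_\lambda$ are bounded operators on $L^2(\Lambda^\infty,\mu)$. A Borel set $A\subseteq\Lambda^\infty$ with $\mu(A)\neq0$ is called $\mu$-invariant if $\mu(A\,\Delta\,(\sigma^n)^{-1}(A))=0$ for all $n\in\mathbb N^k$. A $\mu$-invariant set $E$ is called minimal if there is no $\mu$-invariant $A\subseteq E$ with $\mu(A\,\Delta\,E)\ne0$. Theorem. Let $E\subseteq\Lambda^\infty$ be a minimal $\mu$-invariant set. Let $C^*(\Lambda)$ be the universal $C^*$-algebra generated by a Cuntz–Krieger $\Lambda$-family $\{s_\lambda\}_{\lambda\in\Lambda}$. Then there is a representation $\pi$ of $C^*(\Lambda)$ on $L^2(\Lambda^\infty,\mu)$ with $\pi(s_\lambda)=T_\lambda$ for all $\lambda\in\Lambda$; the closed subspace $L^2(E,\mu)$ of functions vanishing $\mu$-a.e. outside $E$ is invariant under $\pi$; and the restriction of $\pi$ to $L^2(E,\mu)$ is an irreducible representation of $C^*(\Lambda)$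 (it is nonzero and its only closed invariant subspaces are $0$ and $L^2(E,\mu)$). Cofinality of $\Lambda$ is not assumed. -/

import Mathlib

universe u

namespace HigherRank

open CategoryTheory MeasureTheory
open scoped ENNReal symmDiff

noncomputable section

/-! ### Higher-rank graphs -/

/-- The set of all morphisms of a small category (the "arrows-only" picture). For a `k`-graph this
is the set of finite paths; `src` and `rng` are the source and the range maps. -/
@[ext]
structure Mor (V : Type u) [SmallCategory V] : Type u where
  src : V
  rng : V
  hom : src ⟶ rng

namespace Mor

variable {V : Type u} [SmallCategory V]

/-- The identity morphism at `v`, i.e. the vertex `v` regarded as a path. -/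
def vertex (v : V) : Mor V := ⟨v, v, 𝟙 v⟩

/-- The product `a b` of two paths with `s(a) = r(b)`: first `b`, then `a`. -/
abbrev comp (a b : Mor V) (h : a.src = b.rng) : Mor V :=
  ⟨b.src, a.rng, b.hom ≫ eqToHom h.symm ≫ a.hom⟩

theorem comp_assoc (a b c : Mor V) (h : a.src = b.rng) (h' : b.src = c.rng) :
    (a.comp b h).comp c h' = a.comp (b.comp c h') h := by
  simp [comp]

theorem comp_congr {a b a' b' : Mor V} (h : a.src = b.rng) (h' : a'.src = b'.rng) (ha : a = a')
    (hb : b = b') : a.comp b h = a'.comp b' h' := by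
  subst ha hb; rfl

theorem comp_vertex (a : Mor V) : a.comp (vertex a.src) rfl = a := by
  simp [comp, vertex]

theorem vertex_comp (a : Mor V) : (vertex a.rng).comp a rfl = a := by
  simp [comp, vertex]

end Mor

/-- A `k`-graph: a countable small category with a degree functor to `ℕ^k` that has the unique
factorization property. -/
class KGraph (k : outParam ℕ) (V : Type u) [SmallCategory V] where
  countable_mor : Countable (Mor V)
  deg : ∀ {v w : V}, (v ⟶ w) → (Fin k → ℕ)
  deg_id : ∀ v : V, deg (𝟙 v) = 0
  deg_comp : ∀ {u v w : V} (f : u ⟶ v) (g : v ⟶ w), deg (f ≫ g) = deg f + deg g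
  factorization : ∀ (l : Mor V) (m n : Fin k → ℕ), deg l.hom = m + n →
    ∃! p : Mor V × Mor V,
      (∃ h : p.1.src = p.2.rng, p.1.comp p.2 h = l) ∧ deg p.1.hom = m ∧ deg p.2.hom = n

variable {k : ℕ} {V : Type u} [SmallCategory V] [KGraph k V]

instance : Countable (Mor V) := KGraph.countable_mor

namespace Mor

/-- The degree of a path. -/
def d (l : Mor V) : Fin k → ℕ := KGraph.deg l.hom

theorem d_vertex (v : V) : (vertex v).d = 0 := KGraph.deg_id v

theorem d_eqToHom {v w : V} (h : v = w) : KGraph.deg (eqToHom h) = (0 : Fin k → ℕ) := by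
  subst h; exact KGraph.deg_id _

theorem d_comp (a b : Mor V) (h : a.src = b.rng) : (a.comp b h).d = a.d + b.d := by
  simp [d, comp, KGraph.deg_comp, d_eqToHom, add_comm]

theorem factor_unique {a b a' b' : Mor V} (h : a.src = b.rng) (h' : a'.src = b'.rng)
    (e : a.comp b h = a'.comp b' h') (hd : a.d = a'.d) : a = a' ∧ b = b' := by
  have hb : b.d = b'.d := by
    have := congrArg Mor.d e
    rw [d_comp, d_comp, hd] at this
    exact add_left_cancel this
  have := (KGraph.factorization (a.comp b h) a.d b.d (d_comp a b h)).unique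
    (y₁ := (a, b)) (y₂ := (a', b')) ⟨⟨h, rfl⟩, rfl, rfl⟩ ⟨⟨h', e.symm⟩, hd.symm, hb.symm⟩
  simpa using this

theorem exists_factor (l : Mor V) (m : Fin k → ℕ) (hm : m ≤ l.d) :
    ∃ p : Mor V × Mor V, (∃ h : p.1.src = p.2.rng, p.1.comp p.2 h = l) ∧ p.1.d = m ∧
      p.2.d = l.d - m := by
  obtain ⟨p, hp, -⟩ := KGraph.factorization l m (l.d - m) (add_tsub_cancel_of_le hm).symm
  exact ⟨p, hp⟩

/-- The initial piece `l(0, m)` of a path `l` with `m ≤ d(l)`. -/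
def head (l : Mor V) (m : Fin k → ℕ) (hm : m ≤ l.d) : Mor V := (l.exists_factor m hm).choose.1

/-- The final piece `l(m, d(l))` of a path `l` with `m ≤ d(l)`. -/
def tail (l : Mor V) (m : Fin k → ℕ) (hm : m ≤ l.d) : Mor V := (l.exists_factor m hm).choose.2

theorem d_head (l : Mor V) (m : Fin k → ℕ) (hm : m ≤ l.d) : (l.head m hm).d = m :=
  (l.exists_factor m hm).choose_spec.2.1

theorem d_tail (l : Mor V) (m : Fin k → ℕ) (hm : m ≤ l.d) : (l.tail m hm).d = l.d - m :=
  (l.exists_factor m hm).choose_spec.2.2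

theorem head_src (l : Mor V) (m : Fin k → ℕ) (hm : m ≤ l.d) :
    (l.head m hm).src = (l.tail m hm).rng :=
  (l.exists_factor m hm).choose_spec.1.choose

theorem head_comp_tail (l : Mor V) (m : Fin k → ℕ) (hm : m ≤ l.d) :
    (l.head m hm).comp (l.tail m hm) (l.head_src m hm) = l :=
  (l.exists_factor m hm).choose_spec.1.choose_spec

/-- The piece `l(p, q)` of a path `l`, where `p ≤ q ≤ d(l)`. -/
def piece (l : Mor V) (p q : Fin k → ℕ) (hpq : p ≤ q) (hq : q ≤ l.d) : Mor V :=
  (l.head q hq).tail p (hpq.trans (l.d_head q hq).ge)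

/-- `l(p, q)` is the unique `b` with `l = a b c`, `d(a) = p` and `d(b) = q - p`. -/
theorem piece_eq (l : Mor V) (p q : Fin k → ℕ) (hpq : p ≤ q) (hq : q ≤ l.d) (a b c : Mor V)
    (hab : a.src = b.rng) (hbc : b.src = c.rng) (e : (a.comp b hab).comp c hbc = l)
    (ha : a.d = p) (hb : b.d = q - p) : l.piece p q hpq hq = b := by
  have h1 : a.comp b hab = l.head q hq := by
    refine (factor_unique (a := a.comp b hab) (b := c) hbc (l.head_src q hq)
      (e.trans (l.head_comp_tail q hq).symm) ?_).1
    rw [d_comp, d_head, ha, hb, add_tsub_cancel_of_le hpq]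
  have h2 := head_comp_tail (l.head q hq) p (hpq.trans (l.d_head q hq).ge)
  refine (factor_unique (head_src _ _ _) hab (h2.trans h1.symm) ?_).2
  rw [d_head, ha]

theorem exists_piece (l : Mor V) (p q : Fin k → ℕ) (hpq : p ≤ q) (hq : q ≤ l.d) :
    ∃ (a c : Mor V) (hab : a.src = (l.piece p q hpq hq).rng)
      (hbc : (l.piece p q hpq hq).src = c.rng),
      (a.comp (l.piece p q hpq hq) hab).comp c hbc = l ∧ a.d = p ∧
        (l.piece p q hpq hq).d = q - p := by
  have hp := hpq.trans (l.d_head q hq).ge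
  have e1 := head_comp_tail (l.head q hq) p hp
  have e2 := head_comp_tail l q hq
  have hs : ((l.head q hq).tail p hp).src = (l.tail q hq).rng := by
    rw [← l.head_src q hq]
    have := congrArg Mor.src e1
    exact this
  refine ⟨(l.head q hq).head p hp, l.tail q hq, head_src _ _ _, hs, ?_, d_head _ _ _, ?_⟩
  · conv_rhs => rw [← e2]
    congr 1
  · rw [piece, d_tail, d_head]

theorem d_piece (l : Mor V) (p q : Fin k → ℕ) (hpq : p ≤ q) (hq : q ≤ l.d) :
    (l.piece p q hpq hq).d = q - p := by
  obtain ⟨_, _, _, _, -, -, h⟩ := l.exists_piece p q hpq hq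
  exact h

theorem piece_src_eq (l : Mor V) (p q r : Fin k → ℕ) (hpq : p ≤ q) (hqr : q ≤ r) (hr : r ≤ l.d) :
    ∃ h : (l.piece p q hpq (hqr.trans hr)).src = (l.piece q r hqr hr).rng,
      (l.piece p q hpq (hqr.trans hr)).comp (l.piece q r hqr hr) h
        = l.piece p r (hpq.trans hqr) hr := by
  obtain ⟨a, c, hab, hbc, e, ha, hb⟩ := l.exists_piece p r (hpq.trans hqr) hr
  set b := l.piece p r (hpq.trans hqr) hr with hbdef
  have hq : q - p ≤ b.d := by rw [hb]; exact tsub_le_tsub_right hqr p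
  have eb := head_comp_tail b (q - p) hq
  have hs : (b.tail (q - p) hq).src = c.rng := by
    rw [← hbc]
    have := congrArg Mor.src eb
    exact this
  have hr' : a.src = (b.head (q - p) hq).rng := by
    rw [hab]
    have := congrArg Mor.rng eb
    exact this.symm
  have e' : (a.comp ((b.head (q - p) hq).comp (b.tail (q - p) hq) (head_src _ _ _)) hr').comp c hs
      = l := (comp_congr _ _ (comp_congr _ _ rfl eb) rfl).trans e
  have h1 : l.piece p q hpq (hqr.trans hr) = b.head (q - p) hq := by
    refine piece_eq l p q hpq _ a _ ((b.tail (q - p) hq).comp c hs) hr' (head_src _ _ _) ?_ ha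
      (d_head _ _ _)
    refine Eq.trans ?_ e'
    exact (comp_assoc (a.comp (b.head (q - p) hq) hr') (b.tail (q - p) hq) c (head_src _ _ _)
      hs).symm.trans (comp_congr _ _ (comp_assoc _ _ _ _ _) rfl)
  have h2 : l.piece q r hqr hr = b.tail (q - p) hq := by
    refine piece_eq l q r hqr _ (a.comp (b.head (q - p) hq) hr') _ c (head_src _ _ _) hs ?_ ?_ ?_
    · exact (comp_congr _ _ (comp_assoc _ _ _ _ _) rfl).trans e'
    · rw [d_comp, ha, d_head, add_tsub_cancel_of_le hpq]
    · rw [d_tail, hb]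
      exact tsub_tsub_tsub_cancel_right hpq
  refine ⟨by rw [h1, h2]; exact head_src _ _ _, ?_⟩
  conv_rhs => rw [← eb]
  congr 1

/-- The pieces of `l` and of a longer path `l b` agree. -/
theorem piece_comp (l b : Mor V) (h : l.src = b.rng) (p q : Fin k → ℕ) (hpq : p ≤ q)
    (hq : q ≤ l.d) (hq' : q ≤ (l.comp b h).d) :
    (l.comp b h).piece p q hpq hq' = l.piece p q hpq hq := by
  obtain ⟨a, c, hab, hbc, e, ha, hb⟩ := l.exists_piece p q hpq hq
  have hc : c.src = b.rng := by
    rw [← h]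
    have := congrArg Mor.src e
    exact this
  refine piece_eq _ p q hpq hq' a _ (c.comp b hc) hab hbc ?_ ha hb
  exact (comp_assoc (a.comp _ hab) c b hbc hc).symm.trans (comp_congr _ _ e rfl)

/-- A path of degree `0` is a vertex. -/
theorem eq_vertex_of_d_eq_zero (l : Mor V) (h : l.d = 0) : l = vertex l.rng := by
  refine (factor_unique (a := l) (b := vertex l.src) (a' := vertex l.rng) (b' := l) rfl rfl ?_
    ?_).1
  · rw [comp_vertex, vertex_comp]
  · rw [h, d_vertex]

end Mor

/-- The set `v Λ^n` of paths of range `v` and degree `n`. -/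
def pathsFrom (v : V) (n : Fin k → ℕ) : Set (Mor V) := {l | l.rng = v ∧ l.d = n}

/-- Row-finiteness: every `v Λ^n` is finite. -/
class RowFinite (V : Type u) [SmallCategory V] [KGraph k V] : Prop where
  finite_pathsFrom : ∀ (v : V) (n : Fin k → ℕ), (pathsFrom v n).Finite

/-- No sources: every `v Λ^n` is nonempty. -/
def NoSources (V : Type u) [SmallCategory V] [KGraph k V] : Prop :=
  ∀ (v : V) (n : Fin k → ℕ), (pathsFrom v n).Nonempty

/-- No sinks: for every vertex `v` and every `i` there is an edge of degree `e_i` with source `v`. -/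
def NoSinks (V : Type u) [SmallCategory V] [KGraph k V] : Prop :=
  ∀ (i : Fin k) (v : V), ∃ l : Mor V, l.src = v ∧ l.d = Pi.single i 1

/-! ### Infinite paths -/

/-- The objects `ℕ^k` of the category `Ω_k`. -/
def Omega (k : ℕ) : Type := Fin k → ℕ

/-- The category `Ω_k` has objects `ℕ^k` and exactly one morphism `(p, q)`, with source `q` and
range `p`, whenever `p ≤ q`. -/
instance (k : ℕ) : SmallCategory (Omega k) where
  Hom q p := PLift (@LE.le (Fin k → ℕ) _ p q)
  id p := ⟨le_refl (α := Fin k → ℕ) p⟩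
  comp f g := ⟨le_trans (α := Fin k → ℕ) g.down f.down⟩

/-- The morphism `(p, q)` of `Ω_k`. -/
def Omega.mor {k : ℕ} (p q : Fin k → ℕ) (h : p ≤ q) : (show Omega k from q) ⟶ (show Omega k from p) :=
  ⟨h⟩

/-- An infinite path: a degree-preserving functor `Ω_k → Λ`, the degree of `(p, q)` being
`q - p`. -/
structure InfPath (V : Type u) [SmallCategory V] [KGraph k V] : Type u where
  toFunctor : Omega k ⥤ V
  deg_map : ∀ (p q : Fin k → ℕ) (h : p ≤ q),
    KGraph.deg (toFunctor.map (Omega.mor p q h)) = q - p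

namespace InfPath

/-- The segment `x(p, q)`. -/
abbrev seg (x : InfPath V) (p q : Fin k → ℕ) (h : p ≤ q) : Mor V :=
  ⟨x.toFunctor.obj q, x.toFunctor.obj p, x.toFunctor.map (Omega.mor p q h)⟩

/-- The range `r(x) = x(0)`. -/
abbrev range (x : InfPath V) : V := x.toFunctor.obj (0 : Fin k → ℕ)

theorem d_seg (x : InfPath V) (p q : Fin k → ℕ) (h : p ≤ q) : (x.seg p q h).d = q - p :=
  x.deg_map p q h

theorem seg_comp_seg (x : InfPath V) (p q r : Fin k → ℕ) (hpq : p ≤ q) (hqr : q ≤ r) :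
    (x.seg p q hpq).comp (x.seg q r hqr) rfl = x.seg p r (hpq.trans hqr) := by
  refine Mor.ext rfl rfl (heq_of_eq ?_)
  change x.toFunctor.map (Omega.mor q r hqr) ≫ 𝟙 _ ≫ x.toFunctor.map (Omega.mor p q hpq) = _
  rw [Category.id_comp, ← Functor.map_comp]
  rfl

theorem ext_seg {x y : InfPath V} (h : ∀ p q hpq, x.seg p q hpq = y.seg p q hpq) : x = y := by
  obtain ⟨F, hF⟩ := x
  obtain ⟨G, hG⟩ := y
  have : F = G := by
    refine CategoryTheory.Functor.hext (fun p => ?_) (fun p q f => ?_)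
    · exact congrArg Mor.src (h p p le_rfl)
    · have := h q p (f.down)
      simp only [seg, Mor.mk.injEq] at this
      exact this.2.2
  subst this
  rfl

/-- An infinite path from its segments. -/
def ofSeg (S : ∀ p q : Fin k → ℕ, p ≤ q → Mor V) (hd : ∀ p q h, (S p q h).d = q - p)
    (hS : ∀ p q r (hpq : p ≤ q) (hqr : q ≤ r), ∃ h : (S p q hpq).src = (S q r hqr).rng,
      (S p q hpq).comp (S q r hqr) h = S p r (hpq.trans hqr)) : InfPath V where
  toFunctor :=
    { obj := fun p => (S p p (le_refl (α := Fin k → ℕ) p)).rng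
      map := fun {q p} f =>
        eqToHom ((hS p q q f.down (le_refl (α := Fin k → ℕ) q)).choose.symm) ≫
        (S p q f.down).hom ≫
        eqToHom (by
          have := congrArg Mor.rng (hS p p q (le_refl (α := Fin k → ℕ) p) f.down).choose_spec
          exact this.symm)
      map_id := fun p => by
        have key : ∀ (l : Mor V) (_ : l = Mor.vertex l.rng) (h1 : l.rng = l.src),
            eqToHom h1 ≫ l.hom = 𝟙 l.rng := by
          rintro ⟨v, w, f⟩ hl h1
          obtain rfl : v = w := h1.symm
          simp only [Mor.vertex, Mor.mk.injEq, heq_eq_eq, true_and] at hl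
          simp [hl]
        have := key (S p p (le_refl (α := Fin k → ℕ) p))
          (Mor.eq_vertex_of_d_eq_zero _ ((hd p p _).trans (tsub_self (α := Fin k → ℕ) p)))
          (hS p p p (le_refl (α := Fin k → ℕ) p) (le_refl (α := Fin k → ℕ) p)).choose.symm
        simpa using this
      map_comp := fun {r q p} f g => by
        have key : ∀ (a b c : Mor V) (h : a.src = b.rng) (_ : a.comp b h = c) (h1 : c.src = b.src)
            (h2 : a.rng = c.rng), c.hom = eqToHom h1 ≫ b.hom ≫ eqToHom h.symm ≫ a.hom ≫
              eqToHom h2 := by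
          intro a b c h e h1 h2
          subst e
          simp [Mor.comp]
        obtain ⟨h, e⟩ := hS p q r g.down f.down
        have e1 := congrArg Mor.src e
        have e2 := congrArg Mor.rng e
        have := key _ _ _ h e e1.symm e2
        change _ ≫ (S p r (le_trans (α := Fin k → ℕ) g.down f.down)).hom ≫ _ = _
        rw [this]
        simp }
  deg_map := fun p q h => by
    simp only [KGraph.deg_comp, Mor.d_eqToHom, zero_add, add_zero]
    exact hd p q h

theorem seg_ofSeg (S : ∀ p q : Fin k → ℕ, p ≤ q → Mor V) (hd : ∀ p q h, (S p q h).d = q - p)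
    (hS : ∀ p q r (hpq : p ≤ q) (hqr : q ≤ r), ∃ h : (S p q hpq).src = (S q r hqr).rng,
      (S p q hpq).comp (S q r hqr) h = S p r (hpq.trans hqr)) (p q : Fin k → ℕ) (h : p ≤ q) :
    (ofSeg S hd hS).seg p q h = S p q h := by
  have key : ∀ (l : Mor V) (v w : V) (h1 : v = l.src) (h2 : l.rng = w),
      (⟨v, w, eqToHom h1 ≫ l.hom ≫ eqToHom h2⟩ : Mor V) = l := by
    intro l v w h1 h2
    subst h1 h2
    simp
  exact key _ _ _ _ _

/-- The shift map: `σ^m(x)(p, q) = x(p + m, q + m)`. -/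
def shift (m : Fin k → ℕ) (x : InfPath V) : InfPath V :=
  ofSeg (fun p q h => x.seg (p + m) (q + m) (add_le_add_left h m))
    (fun p q h => by rw [d_seg]; exact add_tsub_add_eq_tsub_right q m p)
    (fun p q r hpq hqr => ⟨rfl, seg_comp_seg _ _ _ _ _ _⟩)

theorem seg_shift (m : Fin k → ℕ) (x : InfPath V) (p q : Fin k → ℕ) (h : p ≤ q) :
    (shift m x).seg p q h = x.seg (p + m) (q + m) (add_le_add_left h m) :=
  seg_ofSeg _ _ _ p q h

/-- The cylinder set `Z(l) = {x : x(0, d(l)) = l}`. -/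
def cylinder (l : Mor V) : Set (InfPath V) := {x | x.seg 0 l.d (zero_le) = l}

theorem mem_cylinder_vertex (v : V) (x : InfPath V) :
    x ∈ cylinder (Mor.vertex v) ↔ x.range = v := by
  have h0 := Mor.eq_vertex_of_d_eq_zero (x.seg 0 (Mor.vertex v).d (zero_le))
    (by rw [d_seg, Mor.d_vertex]; simp)
  constructor
  · intro h
    exact congrArg Mor.rng h
  · intro h
    rw [cylinder, Set.mem_ofPred_eq, h0]
    exact congrArg Mor.vertex h

/-- The segment `(l x)(p, q)`: the piece from `p` to `q` of the finite path `l x(0, q)`. -/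
def prefixSeg (l : Mor V) (x : InfPath V) (h : l.src = x.range) (p q : Fin k → ℕ) (hpq : p ≤ q) :
    Mor V :=
  (l.comp (x.seg 0 q (zero_le)) h).piece p q hpq
    (by rw [Mor.d_comp, d_seg, tsub_zero]; exact le_add_self)

/-- The piece from `p` to `q` of `l x(0, q)` is that of `l x(0, r)` for all large `r`. -/
theorem prefixSeg_eq (l : Mor V) (x : InfPath V) (h : l.src = x.range) (p q r : Fin k → ℕ)
    (hpq : p ≤ q) (hqr : q ≤ r) (hq : q ≤ (l.comp (x.seg 0 r (zero_le)) h).d) :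
    prefixSeg l x h p q hpq = (l.comp (x.seg 0 r (zero_le)) h).piece p q hpq hq := by
  have e : l.comp (x.seg 0 r (zero_le)) h =
      (l.comp (x.seg 0 q (zero_le)) h).comp (x.seg q r hqr) rfl := by
    rw [Mor.comp_assoc _ _ _ _ rfl]
    congr 1
    exact (x.seg_comp_seg 0 q r zero_le hqr).symm
  have hq' : q ≤ (l.comp (x.seg 0 q (zero_le)) h).d := by
    rw [Mor.d_comp, d_seg, tsub_zero]; exact le_add_self
  have := Mor.piece_comp (l.comp (x.seg 0 q (zero_le)) h) (x.seg q r hqr) rfl p q hpq hq'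
    (by rw [← e]; exact hq)
  rw [prefixSeg, ← this]
  congr 1
  exact e.symm

theorem d_prefixSeg (l : Mor V) (x : InfPath V) (h : l.src = x.range) (p q : Fin k → ℕ)
    (hpq : p ≤ q) : (prefixSeg l x h p q hpq).d = q - p :=
  Mor.d_piece _ _ _ _ _

theorem prefixSeg_comp (l : Mor V) (x : InfPath V) (h : l.src = x.range) (p q r : Fin k → ℕ)
    (hpq : p ≤ q) (hqr : q ≤ r) :
    ∃ e : (prefixSeg l x h p q hpq).src = (prefixSeg l x h q r hqr).rng,
      (prefixSeg l x h p q hpq).comp (prefixSeg l x h q r hqr) e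
        = prefixSeg l x h p r (hpq.trans hqr) := by
  have hr : r ≤ (l.comp (x.seg 0 r (zero_le)) h).d := by
    rw [Mor.d_comp, d_seg, tsub_zero]; exact le_add_self
  rw [prefixSeg_eq l x h p q r hpq hqr (hqr.trans hr)]
  exact Mor.piece_src_eq _ p q r hpq hqr hr

/-- The infinite path `l x`, for `s(l) = r(x)`. -/
def prepend (l : Mor V) (x : InfPath V) (h : l.src = x.range) : InfPath V :=
  ofSeg (prefixSeg l x h) (d_prefixSeg l x h) (prefixSeg_comp l x h)

theorem seg_prepend (l : Mor V) (x : InfPath V) (h : l.src = x.range) (p q : Fin k → ℕ)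
    (hpq : p ≤ q) : (prepend l x h).seg p q hpq = prefixSeg l x h p q hpq :=
  seg_ofSeg _ _ _ p q hpq

/-- `l x` begins with `l`. -/
theorem prepend_mem_cylinder (l : Mor V) (x : InfPath V) (h : l.src = x.range) :
    prepend l x h ∈ cylinder l := by
  rw [cylinder, Set.mem_ofPred_eq, seg_prepend]
  refine Mor.piece_eq _ 0 l.d zero_le _ (Mor.vertex l.rng) l (x.seg 0 l.d zero_le) rfl h ?_
    (Mor.d_vertex _) (tsub_zero _).symm
  congr 1
  exact Mor.vertex_comp l

/-- Removing `l` from `l x` gives `x` back. -/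
theorem shift_prepend (l : Mor V) (x : InfPath V) (h : l.src = x.range) :
    shift l.d (prepend l x h) = x := by
  refine ext_seg fun p q hpq => ?_
  rw [seg_shift, seg_prepend]
  have hq : q ≤ q + l.d := le_self_add
  refine Mor.piece_eq _ _ _ _ _ (l.comp (x.seg 0 p zero_le) h) _ (x.seg q (q + l.d) hq) rfl rfl
    ?_ ?_ ?_
  · rw [Mor.comp_assoc _ _ _ _ rfl, Mor.comp_assoc _ _ _ _ rfl]
    congr 1
    exact (Mor.comp_congr _ rfl rfl (seg_comp_seg _ _ _ _ _ _)).trans (seg_comp_seg _ _ _ _ _ _)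
  · rw [Mor.d_comp, d_seg, tsub_zero, add_comm]
  · rw [d_seg]; exact (add_tsub_add_eq_tsub_right q l.d p).symm

/-- `l x` is the only infinite path that begins with `l` and continues with `x`. -/
theorem eq_prepend (l : Mor V) (x : InfPath V) (h : l.src = x.range) (y : InfPath V)
    (hy : y ∈ cylinder l) (hxy : shift l.d y = x) : y = prepend l x h := by
  refine ext_seg fun p q hpq => ?_
  rw [seg_prepend]
  have hq : q ≤ q + l.d := le_self_add
  subst hxy
  refine (Mor.piece_eq _ _ _ _ _ (y.seg 0 p zero_le) _ (y.seg q (q + l.d) hq) rfl rfl ?_ ?_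
    (d_seg _ _ _ _)).symm
  · refine ((Mor.comp_congr _ rfl (seg_comp_seg _ _ _ _ _ _) rfl).trans
      (seg_comp_seg _ _ _ _ _ _)).trans ?_
    have hl : y.seg 0 l.d zero_le = l := hy
    have h2 : (shift l.d y).seg 0 q zero_le = y.seg l.d (q + l.d) le_add_self := by
      rw [seg_shift]
      simp only [zero_add]
    have h3 := y.seg_comp_seg 0 l.d (q + l.d) zero_le le_add_self
    rw [← h3]
    exact Mor.comp_congr _ _ hl h2.symm
  · rw [d_seg, tsub_zero]

open Classical in
/-- The standard prefixing map `σ_l : Z(s(l)) → Z(l)`, `x ↦ l x`. It is a partial map; outside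
`Z(s(l))` the value is irrelevant (and taken to be `x`). -/
def prefixMap (l : Mor V) (x : InfPath V) : InfPath V :=
  if h : l.src = x.range then prepend l x h else x

/-- The domain `Z(s(l))` of the standard prefixing map. -/
def prefixDomain (l : Mor V) : Set (InfPath V) := cylinder (Mor.vertex l.src)

end InfPath

/-- The topology on the infinite path space generated by the cylinder sets. -/
instance : TopologicalSpace (InfPath V) :=
  TopologicalSpace.generateFrom (Set.range InfPath.cylinder)

instance : MeasurableSpace (InfPath V) := borel (InfPath V)

instance : BorelSpace (InfPath V) := ⟨rfl⟩

/-! ### The `C*`-algebra of a row-finite `k`-graph -/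

/-- Cuntz-Krieger `Λ`-families in a `C*`-algebra. -/
structure IsCKFamily [RowFinite V] {A : Type*} [NonUnitalCStarAlgebra A] (t : Mor V → A) :
    Prop where
  partialIsometry : ∀ l, t l * star (t l) * t l = t l
  isStarProjection : ∀ v, IsStarProjection (t (Mor.vertex v))
  orthogonal : ∀ v w, v ≠ w → t (Mor.vertex v) * t (Mor.vertex w) = 0
  mul : ∀ (a b : Mor V) (h : a.src = b.rng), t a * t b = t (a.comp b h)
  star_mul_self : ∀ l, star (t l) * t l = t (Mor.vertex l.src)
  sum_mul_star : ∀ (v : V) (n : Fin k → ℕ), t (Mor.vertex v) =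
    ∑ l ∈ (RowFinite.finite_pathsFrom v n).toFinset, t l * star (t l)

theorem IsCKFamily.norm_le_one [RowFinite V] {A : Type*} [NonUnitalCStarAlgebra A] {t : Mor V → A}
    (ht : IsCKFamily t) (l : Mor V) : ‖t l‖ ≤ 1 := by
  have hp : ∀ v, ‖t (Mor.vertex v)‖ ≤ 1 := by
    intro v
    have h1 := (ht.isStarProjection v).isSelfAdjoint.star_eq
    have h2 := (ht.isStarProjection v).isIdempotentElem.eq
    have h3 := CStarRing.norm_star_mul_self (x := t (Mor.vertex v))
    rw [h1, h2] at h3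
    nlinarith [norm_nonneg (t (Mor.vertex v))]
  have h3 := CStarRing.norm_star_mul_self (x := t l)
  rw [ht.star_mul_self] at h3
  nlinarith [norm_nonneg (t l), hp l.src]

/-- A `C*`-algebra together with a Cuntz-Krieger `Λ`-family in it. -/
structure CKPair (V : Type u) [SmallCategory V] [KGraph k V] [RowFinite V] : Type (u + 1) where
  A : Type u
  [inst : NonUnitalCStarAlgebra A]
  t : Mor V → A
  isCK : IsCKFamily t

attribute [instance] CKPair.inst

/-- The direct sum of all Cuntz-Krieger `Λ`-families, an element of the `ℓ^∞`-product of all the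
`C*`-algebras that carry such a family. -/
def universalGen [RowFinite V] (l : Mor V) : lp (fun P : CKPair V => P.A) ∞ :=
  ⟨fun P => P.t l, memℓp_infty ⟨1, by rintro _ ⟨P, rfl⟩; exact P.isCK.norm_le_one l⟩⟩

/-- `C*(Λ)`, the universal `C*`-algebra generated by a Cuntz-Krieger `Λ`-family, realized as the
closed `*`-subalgebra generated by the direct sum of all Cuntz-Krieger `Λ`-families. Its universal
property is `KGraphCStar.existsUnique_hom`. -/
def kgraphCStar (V : Type u) [SmallCategory V] [KGraph k V] [RowFinite V] :
    NonUnitalStarSubalgebra ℂ (lp (fun P : CKPair V => P.A) ∞) :=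
  (NonUnitalStarAlgebra.adjoin ℂ (Set.range universalGen)).topologicalClosure

/-- `C*(Λ)` as a type. -/
abbrev KGraphCStar (V : Type u) [SmallCategory V] [KGraph k V] [RowFinite V] : Type (u + 1) :=
  kgraphCStar V

namespace KGraphCStar

variable [RowFinite V]

instance : IsClosed (kgraphCStar V : Set (lp (fun P : CKPair V => P.A) ∞)) :=
  NonUnitalStarSubalgebra.isClosed_topologicalClosure _

/-- The generators `s_l` of `C*(Λ)`. -/
def gen (l : Mor V) : KGraphCStar V :=
  ⟨universalGen l, NonUnitalStarSubalgebra.le_topologicalClosure _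
    (NonUnitalStarAlgebra.subset_adjoin ℂ _ ⟨l, rfl⟩)⟩

/-- The generators form a Cuntz-Krieger family. -/
theorem isCKFamily_gen : IsCKFamily (gen : Mor V → KGraphCStar V) where
  partialIsometry l := by
    apply Subtype.ext; apply lp.ext; funext P
    exact P.isCK.partialIsometry l
  isStarProjection v := by
    constructor
    · apply Subtype.ext; apply lp.ext; funext P
      exact (P.isCK.isStarProjection v).isIdempotentElem
    · apply Subtype.ext; apply lp.ext; funext P
      exact (P.isCK.isStarProjection v).isSelfAdjoint
  orthogonal v w h := by
    apply Subtype.ext; apply lp.ext; funext P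
    exact P.isCK.orthogonal v w h
  mul a b h := by
    apply Subtype.ext; apply lp.ext; funext P
    exact P.isCK.mul a b h
  star_mul_self l := by
    apply Subtype.ext; apply lp.ext; funext P
    exact P.isCK.star_mul_self l
  sum_mul_star v n := by
    apply Subtype.ext; apply lp.ext; funext P
    refine (P.isCK.sum_mul_star v n).trans ?_
    rw [AddSubmonoidClass.coe_finsetSum, lp.coeFn_sum, Finset.sum_apply]
    rfl

/-- Two `*`-homomorphisms from `C*(Λ)` that agree on the generators are equal. -/
theorem hom_ext {A : Type*} [NonUnitalCStarAlgebra A] {φ ψ : KGraphCStar V →⋆ₙₐ[ℂ] A}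
    (h : ∀ l, φ (gen l) = ψ (gen l)) : φ = ψ := by
  set S := NonUnitalStarAlgebra.adjoin ℂ
    (Set.range (universalGen : Mor V → lp (fun P : CKPair V => P.A) ∞)) with hS
  have hle : S ≤ kgraphCStar V := NonUnitalStarSubalgebra.le_topologicalClosure _
  have h1 : ∀ x (hx : x ∈ S), φ ⟨x, hle hx⟩ = ψ ⟨x, hle hx⟩ := by
    intro x hx
    induction hx using NonUnitalStarAlgebra.adjoin_induction with
    | mem x hx =>
      obtain ⟨l, rfl⟩ := hx
      exact h l
    | zero => exact (map_zero φ).trans (map_zero ψ).symm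
    | add x y hx hy ihx ihy =>
      have e : (⟨x + y, hle (add_mem hx hy)⟩ : KGraphCStar V) = ⟨x, hle hx⟩ + ⟨y, hle hy⟩ := rfl
      rw [e, map_add, map_add, ihx, ihy]
    | mul x y hx hy ihx ihy =>
      have e : (⟨x * y, hle (mul_mem hx hy)⟩ : KGraphCStar V) = ⟨x, hle hx⟩ * ⟨y, hle hy⟩ := rfl
      rw [e, map_mul, map_mul, ihx, ihy]
    | smul r x hx ihx =>
      have e : (⟨r • x, hle (SMulMemClass.smul_mem r hx)⟩ : KGraphCStar V) = r • ⟨x, hle hx⟩ := rfl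
      rw [e, map_smul, map_smul, ihx]
    | star x hx ihx =>
      have e : (⟨star x, hle (star_mem hx)⟩ : KGraphCStar V) = star ⟨x, hle hx⟩ := rfl
      rw [e, map_star, map_star, ihx]
  have hφ : Continuous φ :=
    AddMonoidHomClass.continuous_of_bound φ 1 (fun a => by
      rw [one_mul]; exact NonUnitalStarAlgHom.norm_apply_le φ a)
  have hψ : Continuous ψ :=
    AddMonoidHomClass.continuous_of_bound ψ 1 (fun a => by
      rw [one_mul]; exact NonUnitalStarAlgHom.norm_apply_le ψ a)
  ext ⟨x, hx⟩
  obtain ⟨y, hy, hyx⟩ := mem_closure_iff_seq_limit.1 (show x ∈ closure (S : Set _) from hx)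
  have hlim : Filter.Tendsto (fun n => (⟨y n, hle (hy n)⟩ : KGraphCStar V)) Filter.atTop
      (nhds ⟨x, hx⟩) := tendsto_subtype_rng.2 hyx
  refine tendsto_nhds_unique ((hφ.tendsto _).comp hlim) ?_
  refine ((hψ.tendsto _).comp hlim).congr fun n => ?_
  exact (h1 _ (hy n)).symm

/-- The universal property of `C*(Λ)`. -/
theorem existsUnique_hom {A : Type u} [NonUnitalCStarAlgebra A] {t : Mor V → A}
    (ht : IsCKFamily t) : ∃! π : KGraphCStar V →⋆ₙₐ[ℂ] A, ∀ l, π (gen l) = t l := by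
  refine ⟨{ toFun := fun a => (a : lp (fun P : CKPair V => P.A) ∞) ⟨A, t, ht⟩
            map_smul' := fun _ _ => rfl
            map_zero' := rfl
            map_add' := fun _ _ => rfl
            map_mul' := fun _ _ => rfl
            map_star' := fun _ => rfl }, fun l => rfl, fun π hπ => ?_⟩
  refine hom_ext fun l => ?_
  rw [hπ l]
  rfl

end KGraphCStar

/-- An irreducible representation of a `*`-algebra on a Hilbert space: it is nonzero and its only
closed invariant subspaces are `0` and the whole space. -/
def IsIrreducibleRep {A H : Type*} [NonUnitalNonAssocSemiring A] [Star A] [Module ℂ A]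
    [NormedAddCommGroup H] [InnerProductSpace ℂ H] [CompleteSpace H]
    (ρ : A →⋆ₙₐ[ℂ] (H →L[ℂ] H)) : Prop :=
  (∃ a, ρ a ≠ 0) ∧ ∀ K : Submodule ℂ H, IsClosed (K : Set H) →
    (∀ a, ∀ ξ ∈ K, ρ a ξ ∈ K) → K = ⊥ ∨ K = ⊤

/-! ### Semibranching function systems and projective systems -/

section Systems

variable {X : Type*} [MeasurableSpace X]

/-- A semibranching function system on `(X, μ)`, with domains `D i` and maps `τ i : D i → X`. (The
maps are total functions of which only the values on `D i` matter.) -/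
structure IsSemibranching {ι : Type*} (μ : Measure X) (D : ι → Set X) (τ : ι → X → X) :
    Prop where
  countable : Countable ι
  measurableSet_dom : ∀ i, MeasurableSet (D i)
  measure_dom_pos : ∀ i, 0 < μ (D i)
  measure_dom_lt_top : ∀ i, μ (D i) < ∞
  measurable : ∀ i, Measurable (fun x : D i => τ i x)
  measure_compl_iUnion : μ (⋃ i, τ i '' D i)ᶜ = 0
  measure_inter : ∀ i j, i ≠ j → μ (τ i '' D i ∩ τ j '' D j) = 0
  measure_range_lt_top : ∀ i, μ (τ i '' D i) < ∞
  /-- The Radon-Nikodym derivative `Φ = d(μ ∘ τ i)/dμ` exists and is positive a.e. on `D i`. -/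
  radonNikodym : ∀ i, ∃ Φ : X → ℝ≥0∞, Measurable Φ ∧
    (∀ B ⊆ D i, MeasurableSet B → μ (τ i '' B) = ∫⁻ x in B, Φ x ∂μ) ∧
    ∀ᵐ x ∂μ, x ∈ D i → 0 < Φ x

/-- A coding map for a family of maps `τ i : D i → X`. -/
structure IsCodingMap {ι : Type*} (D : ι → Set X) (τ : ι → X → X) (c : X → X) : Prop where
  measurable : Measurable c
  leftInverse : ∀ i, ∀ x ∈ D i, c (τ i x) = x

/-- A `Λ`-semibranching function system on `(X, μ)` with domains `D l`, prefixing maps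
`τ l : D l → X` and coding maps `c m : X → X`. -/
structure IsLambdaSemibranching (μ : Measure X) (D : Mor V → Set X) (τ : Mor V → X → X)
    (c : (Fin k → ℕ) → X → X) : Prop where
  semibranching : ∀ m : Fin k → ℕ,
    IsSemibranching μ (fun l : {l : Mor V // l.d = m} => D l) (fun l => τ l)
  coding : ∀ m : Fin k → ℕ,
    IsCodingMap (fun l : {l : Mor V // l.d = m} => D l) (fun l => τ l) (c m)
  vertex : ∀ v, ∀ x ∈ D (Mor.vertex v), τ (Mor.vertex v) x = x
  range_subset : ∀ a b : Mor V, a.src = b.rng → μ (τ b '' D b \ D a) = 0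
  dom_comp : ∀ (a b : Mor V) (h : a.src = b.rng), μ (D (a.comp b h) ∆ D b) = 0
  comp : ∀ (a b : Mor V) (h : a.src = b.rng),
    ∀ᵐ x ∂μ, x ∈ D b → τ a (τ b x) = τ (a.comp b h) x
  coding_add : ∀ (m n : Fin k → ℕ) (x : X), c m (c n x) = c (m + n) x

/-- A `Λ`-projective system on `(X, μ)`: a `Λ`-semibranching function system with functions
`f l ∈ L²(X, μ)` such that `0 ≠ d(μ ∘ (τ l)⁻¹)/dμ = |f l|²` and `f a · (f b ∘ c (d a)) = f (a b)`
almost everywhere. -/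
structure IsProjectiveSystem (μ : Measure X) (D : Mor V → Set X) (τ : Mor V → X → X)
    (c : (Fin k → ℕ) → X → X) (f : Mor V → X → ℂ) : Prop
    extends IsLambdaSemibranching μ D τ c where
  memLp : ∀ l, MemLp (f l) 2 μ
  ne_zero : ∀ l, ¬ (f l =ᵐ[μ] 0)
  map_eq : ∀ l, (μ.restrict (D l)).map (τ l) = μ.withDensity (fun x => ‖f l x‖ₑ ^ 2)
  mul_comp : ∀ (a b : Mor V) (h : a.src = b.rng),
    (fun x => f a x * f b (c a.d x)) =ᵐ[μ] f (a.comp b h)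

namespace IsProjectiveSystem

variable {μ : Measure X} {D : Mor V → Set X} {τ : Mor V → X → X} {c : (Fin k → ℕ) → X → X}
  {f : Mor V → X → ℂ}

theorem aemeasurable (h : IsProjectiveSystem μ D τ c f) (l : Mor V) :
    AEMeasurable (τ l) (μ.restrict (D l)) :=
  aemeasurable_restrict_of_measurable_subtype ((h.semibranching l.d).measurableSet_dom ⟨l, rfl⟩)
    ((h.semibranching l.d).measurable ⟨l, rfl⟩)

theorem lintegral_eq (h : IsProjectiveSystem μ D τ c f) (l : Mor V) {g : X → ℝ≥0∞}
    (hg : Measurable g) :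
    ∫⁻ x, ‖f l x‖ₑ ^ 2 * g (c l.d x) ∂μ = ∫⁻ x in D l, g x ∂μ := by
  have hc := (h.coding l.d).measurable
  have h1 : ∫⁻ x, g (c l.d x) ∂(μ.restrict (D l)).map (τ l) = ∫⁻ x in D l, g x ∂μ := by
    rw [lintegral_map' (f := fun x => g (c l.d x)) (hg.comp hc).aemeasurable (h.aemeasurable l)]
    refine setLIntegral_congr_fun ((h.semibranching l.d).measurableSet_dom ⟨l, rfl⟩) ?_
    intro x hx
    have := (h.coding l.d).leftInverse ⟨l, rfl⟩ x hx
    simp only at this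
    simp only [this]
  rw [← h1, h.map_eq l, lintegral_withDensity_eq_lintegral_mul₀'
    ((h.memLp l).1.enorm.pow_const 2) (g := fun x => g (c l.d x)) (hg.comp hc).aemeasurable]
  rfl

theorem comp_ae_eq (h : IsProjectiveSystem μ D τ c f) (l : Mor V) {ξ η : X → ℂ}
    (e : ξ =ᵐ[μ] η) :
    (fun x => f l x * ξ (c l.d x)) =ᵐ[μ] fun x => f l x * η (c l.d x) := by
  obtain ⟨N, hN, hNm, hN0⟩ := exists_measurable_superset_of_null (ae_iff.1 e)
  have hc := (h.coding l.d).measurable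
  have h1 := h.lintegral_eq l (g := N.indicator 1) (measurable_one.indicator hNm)
  have h2 : ∫⁻ x in D l, N.indicator 1 x ∂μ = 0 := by
    rw [lintegral_indicator_one hNm]
    exact measure_mono_null (fun _ hx => hx) (Measure.restrict_le_self.absolutelyContinuous hN0)
  rw [h2, lintegral_eq_zero_iff' (f := fun x => ‖f l x‖ₑ ^ 2 * N.indicator 1 (c l.d x))
    (((h.memLp l).1.enorm.pow_const 2).mul
      ((measurable_one.indicator hNm).comp hc).aemeasurable)] at h1
  filter_upwards [h1] with x hx
  by_cases hxN : c l.d x ∈ N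
  · have : f l x = 0 := by simpa [hxN] using hx
    simp [this]
  · have : ξ (c l.d x) = η (c l.d x) := by
      by_contra hne
      exact hxN (hN hne)
    rw [this]

theorem eLpNorm_le (h : IsProjectiveSystem μ D τ c f) (l : Mor V) {ξ : X → ℂ}
    (hξ : StronglyMeasurable ξ) :
    eLpNorm (fun x => f l x * ξ (c l.d x)) 2 μ ≤ eLpNorm ξ 2 μ := by
  have h1 := h.lintegral_eq l (g := fun x => ‖ξ x‖ₑ ^ 2) (hξ.measurable.enorm.pow_const 2)
  have key : ∀ g : X → ℂ, eLpNorm g 2 μ = (∫⁻ x, ‖g x‖ₑ ^ 2 ∂μ) ^ (1 / 2 : ℝ) := by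
    intro g
    rw [eLpNorm_eq_lintegral_rpow_enorm_toReal (by norm_num) (by norm_num)]
    simp
  rw [key, key]
  refine ENNReal.rpow_le_rpow ?_ (by norm_num)
  simp only [enorm_mul, mul_pow]
  rw [h1]
  exact setLIntegral_le_lintegral _ _

theorem memLp_mul_comp (h : IsProjectiveSystem μ D τ c f) (l : Mor V) (ξ : Lp ℂ 2 μ) :
    MemLp (fun x => f l x * ξ (c l.d x)) 2 μ :=
  ⟨(h.memLp l).1.mul ((Lp.stronglyMeasurable ξ).comp_measurable
      (h.coding l.d).measurable).aestronglyMeasurable,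
    (h.eLpNorm_le l (Lp.stronglyMeasurable ξ)).trans_lt (Lp.eLpNorm_lt_top ξ)⟩

/-- The operator `T_l ξ = f_l · (ξ ∘ c^{d(l)})` on `L²(X, μ)`. -/
def T (h : IsProjectiveSystem μ D τ c f) (l : Mor V) : Lp ℂ 2 μ →L[ℂ] Lp ℂ 2 μ :=
  LinearMap.mkContinuous
    { toFun := fun ξ => (h.memLp_mul_comp l ξ).toLp _
      map_add' := fun ξ η => by
        rw [← MemLp.toLp_add, MemLp.toLp_eq_toLp_iff]
        refine (h.comp_ae_eq l (Lp.coeFn_add ξ η)).trans (.of_forall fun x => ?_)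
        simp [mul_add]
      map_smul' := fun a ξ => by
        rw [RingHom.id_apply, ← MemLp.toLp_const_smul, MemLp.toLp_eq_toLp_iff]
        refine (h.comp_ae_eq l (Lp.coeFn_smul a ξ)).trans (.of_forall fun x => ?_)
        simp [mul_left_comm] }
    1 (fun ξ => by
      rw [one_mul]
      refine (Lp.norm_toLp _ (h.memLp_mul_comp l ξ)).trans_le ?_
      rw [Lp.norm_def]
      exact ENNReal.toReal_mono (Lp.eLpNorm_ne_top ξ) (h.eLpNorm_le l (Lp.stronglyMeasurable ξ)))

theorem coeFn_T (h : IsProjectiveSystem μ D τ c f) (l : Mor V) (ξ : Lp ℂ 2 μ) :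
    h.T l ξ =ᵐ[μ] fun x => f l x * ξ (c l.d x) :=
  MemLp.coeFn_toLp (h.memLp_mul_comp l ξ)

end IsProjectiveSystem

/-- `L²(E, μ)`, as the subspace of `L²(X, μ)` of the functions that vanish a.e. outside `E`. -/
def L2On (μ : Measure X) (E : Set X) : Submodule ℂ (Lp ℂ 2 μ) where
  carrier := {ξ | ∀ᵐ x ∂μ, x ∉ E → ξ x = 0}
  zero_mem' := by
    filter_upwards [Lp.coeFn_zero ℂ 2 μ] with x hx _
    simpa using hx
  add_mem' := by
    intro ξ η hξ hη
    filter_upwards [hξ, hη, Lp.coeFn_add ξ η] with x h1 h2 h3 hx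
    rw [h3, Pi.add_apply, h1 hx, h2 hx, add_zero]
  smul_mem' := by
    intro a ξ hξ
    filter_upwards [hξ, Lp.coeFn_smul a ξ] with x h1 h3 hx
    rw [h3, Pi.smul_apply, h1 hx, smul_zero]

theorem isClosed_L2On (μ : Measure X) (E : Set X) : IsClosed (L2On μ E : Set (Lp ℂ 2 μ)) := by
  have : (L2On μ E : Set (Lp ℂ 2 μ)) = (LpToLpRestrictCLM X ℂ ℂ μ 2 Eᶜ) ⁻¹' {0} := by
    ext ξ
    have hm : MeasurableSet {x | ξ x = 0} :=
      (Lp.stronglyMeasurable ξ).measurable (measurableSet_singleton 0)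
    have h1 : ξ ∈ L2On μ E ↔ ∀ᵐ x ∂μ.restrict Eᶜ, ξ x = 0 := (ae_restrict_iff hm).symm
    rw [SetLike.mem_coe, h1, Set.mem_preimage, Set.mem_singleton_iff, Lp.eq_zero_iff_ae_eq_zero]
    have h2 := LpToLpRestrictCLM_coeFn (p := 2) (μ := μ) ℂ Eᶜ ξ
    exact ⟨fun h => h2.trans h, fun h => h2.symm.trans h⟩
  rw [this]
  exact isClosed_singleton.preimage (LpToLpRestrictCLM X ℂ ℂ μ 2 Eᶜ).continuous

instance (μ : Measure X) (E : Set X) : CompleteSpace (L2On μ E) :=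
  (isClosed_L2On μ E).completeSpace_coe

end Systems

/-! ### Invariant subsets of the infinite path space -/

/-- `μ`-invariant subsets of `Λ^∞`: Borel sets of non-zero measure with `μ(A ∆ (σ^n)⁻¹(A)) = 0` for
all `n`. -/
def IsMuInvariant (μ : Measure (InfPath V)) (A : Set (InfPath V)) : Prop :=
  MeasurableSet A ∧ μ A ≠ 0 ∧ ∀ n : Fin k → ℕ, μ (A ∆ (InfPath.shift n ⁻¹' A)) = 0

/-- Minimal `μ`-invariant subsets of `Λ^∞`. -/
def IsMinimalMuInvariant (μ : Measure (InfPath V)) (E : Set (InfPath V)) : Prop :=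
  IsMuInvariant μ E ∧ ¬ ∃ A ⊆ E, IsMuInvariant μ A ∧ μ (A ∆ E) ≠ 0

/-- `Λ`-projective systems on `(Λ^∞, μ)` for the standard prefixing maps
`σ_l : Z(s(l)) → Z(l)` and the standard coding maps `σ^n`. -/
abbrev IsStandardProjectiveSystem (μ : Measure (InfPath V)) (f : Mor V → InfPath V → ℂ) : Prop :=
  IsProjectiveSystem μ InfPath.prefixDomain InfPath.prefixMap InfPath.shift f

end

end HigherRank

/-! The projective relations turn the `T_l` into a Cuntz-Krieger family whose initial and range
projections are multiplication operators: `T_l* T_l` is multiplication by the indicator of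
`Z(s(l))`, and `T_l T_l*` is multiplication by the indicator of `Z(l)`. The first is the change of
variables in `lintegral_eq`. The second rests on `ae_ne_zero_iff`: up to null sets, `f_l` is nonzero
exactly on `Z(l)`, so one can divide by it and solve `T_l ξ = η` for every `η` supported in `Z(l)`
(`exists_T_eq`). The universal property then gives `π`.

Two dictionaries between sets and operators do the rest. For a Borel set `A`, multiplication by
`1_A` commutes with every `T_l` if and only if `A` is shift-invariant modulo null sets
(`indicatorL2_commute_T`, `measure_symmDiff_shift_of_commute`). And a closed subspace that is stable
under all indicator multiplications is `L²(A)` for some `A` (`exists_eq_L2On`).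

The first makes `L²(E)` invariant under `π`. Conversely, a closed `π`-invariant subspace `K` of
`L²(E)` is stable under `T_l` and `T_l*`, hence under every `1_{Z(l)} = T_l T_l*`. Cylinders
generate the Borel sets, so `K` is stable under all indicators and `K = L²(A)`. Stability under
`T_l` and `T_l*` makes `1_A` commute with `T_l`, so `A` is shift-invariant
(`exists_eq_L2On_of_invariant`). Then `A ∩ E` is null or invariant, and in the second case
minimality gives `A ∩ E = E` almost everywhere. Thus `K` is `0` or `L²(E)`. -/

namespace HigherRank

open CategoryTheory MeasureTheory
open scoped ENNReal symmDiff

noncomputable section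

/-! ### Multiplication by indicators and the subspaces `L²(A)` -/

section IndicatorOperators

variable {X : Type*} [MeasurableSpace X] {μ : Measure X}

theorem memLp_indicator_coeFn {B : Set X} (hB : MeasurableSet B) (ξ : Lp ℂ 2 μ) :
    MemLp (fun x => B.indicator ξ x) 2 μ :=
  (Lp.memLp ξ).indicator hB

theorem eLpNorm_indicator_coeFn_le (B : Set X) (ξ : Lp ℂ 2 μ) :
    eLpNorm (fun x => B.indicator ξ x) 2 μ ≤ eLpNorm ξ 2 μ :=
  eLpNorm_indicator_le _

/-- Multiplication by the indicator function of `B`, as an operator on `L²(X, μ)`. -/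
def indicatorL2 (μ : Measure X) (B : Set X) (hB : MeasurableSet B) :
    Lp ℂ 2 μ →L[ℂ] Lp ℂ 2 μ :=
  LinearMap.mkContinuous
    { toFun := fun ξ => (memLp_indicator_coeFn hB ξ).toLp _
      map_add' := fun ξ η => by
        rw [← MemLp.toLp_add, MemLp.toLp_eq_toLp_iff]
        filter_upwards [Lp.coeFn_add ξ η] with x hx
        rw [Pi.add_apply]
        by_cases h : x ∈ B
        · simp only [Set.indicator_of_mem h, hx, Pi.add_apply]
        · simp only [Set.indicator_of_notMem h, add_zero]
      map_smul' := fun a ξ => by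
        rw [RingHom.id_apply, ← MemLp.toLp_const_smul, MemLp.toLp_eq_toLp_iff]
        filter_upwards [Lp.coeFn_smul a ξ] with x hx
        rw [Pi.smul_apply]
        by_cases h : x ∈ B
        · simp only [Set.indicator_of_mem h, hx, Pi.smul_apply]
        · simp only [Set.indicator_of_notMem h, smul_zero] }
    1 (fun ξ => by
      rw [one_mul]
      refine (Lp.norm_toLp _ (memLp_indicator_coeFn hB ξ)).trans_le ?_
      rw [Lp.norm_def]
      exact ENNReal.toReal_mono (Lp.eLpNorm_ne_top ξ) (eLpNorm_indicator_coeFn_le B ξ))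

theorem coeFn_indicatorL2 (B : Set X) (hB : MeasurableSet B) (ξ : Lp ℂ 2 μ) :
    indicatorL2 μ B hB ξ =ᵐ[μ] B.indicator ξ :=
  MemLp.coeFn_toLp (memLp_indicator_coeFn hB ξ)

theorem inner_indicatorL2_left (B : Set X) (hB : MeasurableSet B) (ξ η : Lp ℂ 2 μ) :
    inner ℂ (indicatorL2 μ B hB ξ) η = ∫ x in B, inner ℂ (ξ x) (η x) ∂μ := by
  rw [L2.inner_def, ← integral_indicator hB]
  refine integral_congr_ae ?_
  filter_upwards [coeFn_indicatorL2 B hB ξ] with x hx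
  by_cases h : x ∈ B <;> simp [h, hx]

theorem inner_indicatorL2_right (B : Set X) (hB : MeasurableSet B) (ξ η : Lp ℂ 2 μ) :
    inner ℂ ξ (indicatorL2 μ B hB η) = ∫ x in B, inner ℂ (ξ x) (η x) ∂μ := by
  rw [L2.inner_def, ← integral_indicator hB]
  refine integral_congr_ae ?_
  filter_upwards [coeFn_indicatorL2 B hB η] with x hx
  by_cases h : x ∈ B <;> simp [h, hx]

theorem star_indicatorL2 (B : Set X) (hB : MeasurableSet B) :
    star (indicatorL2 μ B hB) = indicatorL2 μ B hB := by
  rw [ContinuousLinearMap.star_eq_adjoint, eq_comm, ContinuousLinearMap.eq_adjoint_iff]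
  intro ξ η
  rw [inner_indicatorL2_left, inner_indicatorL2_right]

theorem indicatorL2_mul (B C : Set X) (hB : MeasurableSet B) (hC : MeasurableSet C) :
    indicatorL2 μ B hB * indicatorL2 μ C hC = indicatorL2 μ (B ∩ C) (hB.inter hC) := by
  ext1 ξ
  refine Lp.ext ?_
  filter_upwards [coeFn_indicatorL2 B hB (indicatorL2 μ C hC ξ), coeFn_indicatorL2 C hC ξ,
    coeFn_indicatorL2 _ (hB.inter hC) ξ] with x h1 h2 h3
  rw [mul_apply_eq_comp, h1, h3]
  by_cases hb : x ∈ B <;> by_cases hc : x ∈ C <;> simp [hb, hc, h2]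

theorem isStarProjection_indicatorL2 (B : Set X) (hB : MeasurableSet B) :
    IsStarProjection (indicatorL2 μ B hB) := by
  refine ⟨?_, star_indicatorL2 B hB⟩
  rw [IsIdempotentElem, indicatorL2_mul]
  congr 1
  exact Set.inter_self _

theorem indicatorL2_empty : indicatorL2 μ ∅ MeasurableSet.empty = 0 := by
  ext1 ξ
  refine Lp.ext ?_
  filter_upwards [coeFn_indicatorL2 ∅ MeasurableSet.empty ξ, Lp.coeFn_zero ℂ 2 μ] with x h1 h2
  rw [h1, zero_apply, h2]
  simp

theorem indicatorL2_compl (B : Set X) (hB : MeasurableSet B) :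
    indicatorL2 μ Bᶜ hB.compl = 1 - indicatorL2 μ B hB := by
  ext1 ξ
  refine Lp.ext ?_
  filter_upwards [coeFn_indicatorL2 B hB ξ, coeFn_indicatorL2 _ hB.compl ξ,
    Lp.coeFn_sub ξ (indicatorL2 μ B hB ξ)] with x h1 h2 h3
  change _ = (ξ - indicatorL2 μ B hB ξ : Lp ℂ 2 μ) x
  rw [h3, h2, Pi.sub_apply, h1]
  by_cases h : x ∈ B <;> simp [h]

/-- Tested against a vector `η`, this is finite additivity of the integral of `⟨ξ, η⟩` over disjoint
sets. It supplies the summation relation of a Cuntz-Krieger family. -/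
theorem sum_indicatorL2 {ι : Type*} (s : Finset ι) (B : ι → Set X) (hB : ∀ i, MeasurableSet (B i))
    (hd : Set.Pairwise (s : Set ι) (Function.onFun Disjoint B)) (C : Set X) (hC : MeasurableSet C)
    (h : C = ⋃ i ∈ s, B i) : indicatorL2 μ C hC = ∑ i ∈ s, indicatorL2 μ (B i) (hB i) := by
  ext1 ξ
  refine ext_inner_right ℂ fun η => ?_
  rw [inner_indicatorL2_left, sum_apply, sum_inner, h,
    integral_biUnion_finset s (fun i _ => hB i) hd
      (fun i _ => (L2.integrable_inner (𝕜 := ℂ) ξ η).integrableOn)]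
  exact Finset.sum_congr rfl fun i _ => (inner_indicatorL2_left _ (hB i) ξ η).symm

theorem mem_L2On_iff (B : Set X) (hB : MeasurableSet B) (ξ : Lp ℂ 2 μ) :
    ξ ∈ L2On μ B ↔ indicatorL2 μ B hB ξ = ξ := by
  constructor
  · intro h
    refine Lp.ext ?_
    filter_upwards [coeFn_indicatorL2 B hB ξ, h] with x h1 h2
    rw [h1]
    by_cases hx : x ∈ B
    · simp [hx]
    · simp [hx, h2 hx]
  · intro h
    have h1 := coeFn_indicatorL2 B hB ξ
    rw [h] at h1
    filter_upwards [h1] with x hx hxB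
    rw [hx, Set.indicator_of_notMem hxB]

theorem indicatorL2_mem_L2On (B : Set X) (hB : MeasurableSet B) (ξ : Lp ℂ 2 μ) :
    indicatorL2 μ B hB ξ ∈ L2On μ B := by
  filter_upwards [coeFn_indicatorL2 B hB ξ] with x hx hxB
  rw [hx, Set.indicator_of_notMem hxB]

theorem L2On_congr {A B : Set X} (h : A =ᵐ[μ] B) : L2On μ A = L2On μ B := by
  ext ξ
  change (∀ᵐ x ∂μ, x ∉ A → ξ x = 0) ↔ ∀ᵐ x ∂μ, x ∉ B → ξ x = 0
  refine Filter.eventually_congr ?_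
  filter_upwards [h] with x hx
  have : x ∈ A ↔ x ∈ B := iff_of_eq hx
  rw [this]

theorem L2On_eq_bot {A : Set X} (h : μ A = 0) : L2On μ A = ⊥ := by
  rw [eq_bot_iff]
  intro ξ hξ
  rw [Submodule.mem_bot, Lp.eq_zero_iff_ae_eq_zero]
  filter_upwards [hξ, measure_eq_zero_iff_ae_notMem.1 h] with x h1 h2
  exact h1 h2

/-- Take the square root of a strictly positive integrable function. Such a `g` is a test vector
that sees every set of positive measure. -/
theorem exists_memLp_two_forall_ne_zero (μ : Measure X) [SigmaFinite μ] :
    ∃ g : X → ℂ, MemLp g 2 μ ∧ ∀ x, g x ≠ 0 := by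
  obtain ⟨g, hg, hgm, hgi⟩ := exists_pos_lintegral_lt_of_sigmaFinite μ (ε := 1) one_ne_zero
  have hm : MemLp (fun x => ((NNReal.sqrt (g x) : ℝ) : ℂ)) 2 μ := by
    refine ⟨(Complex.measurable_ofReal.comp (measurable_coe_nnreal_real.comp
      (NNReal.continuous_sqrt.measurable.comp hgm))).aestronglyMeasurable, ?_⟩
    rw [eLpNorm_lt_top_iff_lintegral_rpow_enorm_lt_top (by norm_num) (by norm_num)]
    refine lt_of_eq_of_lt (lintegral_congr fun x => ?_) (hgi.trans ENNReal.one_lt_top)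
    have : ‖((NNReal.sqrt (g x) : ℝ) : ℂ)‖ₑ = (NNReal.sqrt (g x) : ℝ≥0∞) := by
      rw [← ofReal_norm, Complex.norm_real, Real.norm_of_nonneg (NNReal.coe_nonneg _),
        ENNReal.ofReal_coe_nnreal]
    rw [this]
    have h2 : ((2 : ℝ≥0∞).toReal) = ((2 : ℕ) : ℝ) := by norm_num
    rw [h2, ENNReal.rpow_natCast, ← ENNReal.coe_pow, NNReal.sq_sqrt]
  refine ⟨_, hm, fun x => ?_⟩
  have := NNReal.sqrt_pos.2 (hg x)
  exact_mod_cast this.ne'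

/-- A vector orthogonal to all the truncations of `h` vanishes where `h` does not. -/
theorem ae_eq_zero_or_of_inner_indicatorL2 (h η : Lp ℂ 2 μ)
    (H : ∀ B (hB : MeasurableSet B), inner ℂ (indicatorL2 μ B hB h) η = 0) :
    ∀ᵐ x ∂μ, h x = 0 ∨ η x = 0 := by
  have h0 := (L2.integrable_inner (𝕜 := ℂ) h η).ae_eq_zero_of_forall_setIntegral_eq_zero
    (fun s hs _ => by rw [← inner_indicatorL2_left s hs]; exact H s hs)
  filter_upwards [h0] with x hx
  simpa [or_comm] using hx

/-- A closed subspace of `L²(X, μ)` that is invariant under multiplication by indicator functions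
is `L²(A, μ)` for some `A`. -/
theorem exists_eq_L2On [SigmaFinite μ] (K : Submodule ℂ (Lp ℂ 2 μ))
    (hK : IsClosed (K : Set (Lp ℂ 2 μ)))
    (H : ∀ B (hB : MeasurableSet B), ∀ ξ ∈ K, indicatorL2 μ B hB ξ ∈ K) :
    ∃ A, MeasurableSet A ∧ K = L2On μ A := by
  have : CompleteSpace K := hK.completeSpace_coe
  obtain ⟨g, hg⟩ : ∃ g : Lp ℂ 2 μ, ∀ᵐ x ∂μ, g x ≠ 0 := by
    obtain ⟨g, hm, hg⟩ := exists_memLp_two_forall_ne_zero μ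
    refine ⟨hm.toLp g, ?_⟩
    filter_upwards [hm.coeFn_toLp] with x hx
    rw [hx]
    exact hg x
  -- The set will be the support of the projection `h` of `g` onto `K`. Since `g` vanishes nowhere,
  -- `h` and `g - h` cannot both vanish at a point.
  set h : Lp ℂ 2 μ := K.starProjection g with hdef
  have hK1 : h ∈ K := K.starProjection_apply_mem g
  have hK2 : g - h ∈ Kᗮ := K.sub_starProjection_mem_orthogonal g
  -- Invariance under truncation upgrades orthogonality of `K` and its complement to disjointness of
  -- supports.
  have key : ∀ ξ ∈ K, ∀ η ∈ Kᗮ, ∀ᵐ x ∂μ, ξ x = 0 ∨ η x = 0 := fun ξ hξ η hη =>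
    ae_eq_zero_or_of_inner_indicatorL2 ξ η fun B hB =>
      Submodule.inner_right_of_mem_orthogonal (H B hB ξ hξ) hη
  have hsub := Lp.coeFn_sub g h
  have hm : MeasurableSet {x | h x ≠ 0} :=
    ((Lp.stronglyMeasurable h).measurable (measurableSet_singleton 0)).compl
  refine ⟨{x | h x ≠ 0}, hm, le_antisymm ?_ ?_⟩
  -- Where `h` vanishes, `g - h = g` is nonzero and lies in the orthogonal complement of `K`, so `ξ`
  -- vanishes there.
  · intro ξ hξ
    filter_upwards [key ξ hξ _ hK2, hg, hsub] with x h1 h2 h3 h4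
    rcases h1 with h1 | h1
    · exact h1
    · have h5 : h x = 0 := not_not.1 h4
      rw [h3, Pi.sub_apply, h5, sub_zero] at h1
      exact absurd h1 h2
  -- Every `η` orthogonal to `K` vanishes where `h` does not, hence is orthogonal to `ξ`. Closedness
  -- of `K` enters through the double orthogonal complement.
  · intro ξ hξ
    rw [← K.orthogonal_orthogonal, Submodule.mem_orthogonal]
    intro η hη
    rw [L2.inner_def]
    refine integral_eq_zero_of_ae ?_
    filter_upwards [key h hK1 η hη, hξ] with x h1 h2
    rcases h1 with h1 | h1
    · simp [h2 (not_not.2 h1)]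
    · simp [h1]

/-- A closed subspace that is invariant under multiplication by the indicator functions of a
generating family of sets is invariant under multiplication by all indicator functions. -/
theorem indicatorL2_mem_of_generateFrom (K : Submodule ℂ (Lp ℂ 2 μ))
    (hK : IsClosed (K : Set (Lp ℂ 2 μ))) (C : Set (Set X))
    (hC : ‹MeasurableSpace X› = MeasurableSpace.generateFrom C)
    (H : ∀ B ∈ C, ∀ hB : MeasurableSet B, ∀ ξ ∈ K, indicatorL2 μ B hB ξ ∈ K)
    (B : Set X) (hB : MeasurableSet B) : ∀ ξ ∈ K, indicatorL2 μ B hB ξ ∈ K := by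
  have : CompleteSpace K := hK.completeSpace_coe
  let P : Set X → Prop := fun B => ∃ hB : MeasurableSet B, ∀ ξ ∈ K, indicatorL2 μ B hB ξ ∈ K
  have hcompl : ∀ B, P B → P Bᶜ := by
    rintro B ⟨hB, h⟩
    refine ⟨hB.compl, fun ξ hξ => ?_⟩
    rw [indicatorL2_compl B hB]
    exact K.sub_mem hξ (h ξ hξ)
  have hinter : ∀ B C, P B → P C → P (B ∩ C) := by
    rintro B C ⟨hB, h⟩ ⟨hC, h'⟩
    refine ⟨hB.inter hC, fun ξ hξ => ?_⟩
    rw [← indicatorL2_mul B C hB hC]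
    exact h _ (h' _ hξ)
  have hunion : ∀ s : ℕ → Set X, (∀ n, P (s n)) → P (⋃ n, s n) := by
    intro s hs
    -- Disjointification uses only intersections and complements, so the pieces stay in the class.
    -- For disjoint pieces, membership in `K` is then checked against its orthogonal complement by
    -- countable additivity of the integral.
    have hd : ∀ n, P (disjointed s n) := fun n =>
      disjointedRec (p := P) (fun t i ht => by
        rw [Set.sdiff_eq]; exact hinter _ _ ht (hcompl _ (hs i))) (hs n)
    rw [← iUnion_disjointed]
    refine ⟨MeasurableSet.iUnion fun n => (hd n).1, fun ξ hξ => ?_⟩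
    rw [← K.orthogonal_orthogonal, Submodule.mem_orthogonal']
    intro η hη
    rw [inner_indicatorL2_left (⋃ n, disjointed s n) (MeasurableSet.iUnion fun n => (hd n).1) ξ η,
      integral_iUnion (fun n => (hd n).1) (disjoint_disjointed s)
      (L2.integrable_inner (𝕜 := ℂ) ξ η).integrableOn]
    refine (tsum_congr fun n => ?_).trans tsum_zero
    rw [← inner_indicatorL2_left _ (hd n).1]
    exact Submodule.inner_right_of_mem_orthogonal ((hd n).2 ξ hξ) hη
  have hP : P B := by
    have hB' := hB
    rw [hC] at hB'
    refine MeasurableSpace.generateFrom_induction C (fun t _ => P t) (fun t ht htm => ?_)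
      ⟨MeasurableSet.empty, fun ξ _ => ?_⟩ (fun t _ ih => hcompl t ih) (fun s _ ih => hunion s ih)
      B hB'
    · have htm' : MeasurableSet t := by rw [hC]; exact htm
      exact ⟨htm', H t ht htm'⟩
    · rw [indicatorL2_empty]
      exact K.zero_mem
  exact hP.2

end IndicatorOperators

variable {k : ℕ} {V : Type u} [SmallCategory V] [KGraph k V]

/-! ### Cylinders, shifts and prefixing -/

namespace InfPath

theorem isOpen_cylinder (l : Mor V) : IsOpen (cylinder l) :=
  TopologicalSpace.isOpen_generateFrom_of_mem ⟨l, rfl⟩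

theorem measurableSet_cylinder (l : Mor V) : MeasurableSet (cylinder l) :=
  (isOpen_cylinder l).measurableSet

instance : SecondCountableTopology (InfPath V) :=
  ⟨Set.range cylinder, Set.countable_range _, rfl⟩

/-- There are countably many finite paths, so the cylinders are a countable subbasis and already
generate the Borel sets. -/
theorem measurableSpace_eq_generateFrom :
    (inferInstance : MeasurableSpace (InfPath V)) =
      MeasurableSpace.generateFrom (Set.range cylinder) :=
  borel_eq_generateFrom_of_subbasis rfl

theorem shift_zero (x : InfPath V) : shift 0 x = x :=
  ext_seg fun p q h => by
    rw [seg_shift]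
    simp only [add_zero]

theorem range_shift (m : Fin k → ℕ) (x : InfPath V) :
    (shift m x).range = (x.seg 0 m zero_le).src := by
  have h := congrArg Mor.rng (seg_shift m x 0 0 le_rfl)
  simp only [zero_add] at h
  exact h

theorem shift_mem_prefixDomain {l : Mor V} {x : InfPath V} (hx : x ∈ cylinder l) :
    shift l.d x ∈ prefixDomain l := by
  rw [prefixDomain, mem_cylinder_vertex, range_shift]
  exact congrArg Mor.src hx

theorem prefixMap_shift {l : Mor V} {x : InfPath V} (hx : x ∈ cylinder l) :
    prefixMap l (shift l.d x) = x := by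
  have h : l.src = (shift l.d x).range :=
    ((mem_cylinder_vertex _ _).1 (shift_mem_prefixDomain hx)).symm
  rw [prefixMap, dif_pos h]
  exact (eq_prepend l _ h x hx rfl).symm

theorem prefixMap_mem_cylinder {l : Mor V} {x : InfPath V} (hx : x ∈ prefixDomain l) :
    prefixMap l x ∈ cylinder l := by
  have h : l.src = x.range := ((mem_cylinder_vertex _ _).1 hx).symm
  rw [prefixMap, dif_pos h]
  exact prepend_mem_cylinder l x h

theorem disjoint_cylinder {a b : Mor V} (hd : a.d = b.d) (hab : a ≠ b) :
    Disjoint (cylinder a) (cylinder b) := by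
  rw [Set.disjoint_left]
  intro x hxa hxb
  have h1 : x.seg 0 a.d zero_le = a := hxa
  have h2 : x.seg 0 b.d zero_le = b := hxb
  apply hab
  rw [← h1, ← h2]
  simp only [hd]

theorem mem_cylinder_seg (x : InfPath V) (n : Fin k → ℕ) :
    x ∈ cylinder (x.seg 0 n zero_le) := by
  have h : (x.seg 0 n zero_le).d = n := by rw [d_seg, tsub_zero]
  -- The degree of `x(0, n)` equals `n` only propositionally, so it is generalized before
  -- substituting.
  have key : ∀ m : Fin k → ℕ, m = n → x.seg 0 m zero_le = x.seg 0 n zero_le := by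
    rintro m rfl
    rfl
  exact key _ h

theorem measurableSet_prefixDomain (l : Mor V) : MeasurableSet (prefixDomain l) :=
  measurableSet_cylinder _

theorem range_of_mem_cylinder {l : Mor V} {x : InfPath V} (hx : x ∈ cylinder l) :
    x.range = l.rng :=
  congrArg Mor.rng hx

theorem cylinder_vertex_eq_biUnion [RowFinite V] (v : V) (n : Fin k → ℕ) :
    cylinder (Mor.vertex v) =
      ⋃ l ∈ (RowFinite.finite_pathsFrom v n).toFinset, cylinder l := by
  ext x
  simp only [Set.mem_iUnion, Set.Finite.mem_toFinset, exists_prop, mem_cylinder_vertex]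
  constructor
  · intro h
    exact ⟨x.seg 0 n zero_le, ⟨h, by rw [d_seg, tsub_zero]⟩, x.mem_cylinder_seg n⟩
  · rintro ⟨l, ⟨hl, -⟩, hx⟩
    rw [range_of_mem_cylinder hx, hl]

end InfPath

open InfPath

theorem countable_vertices (V : Type u) [SmallCategory V] [KGraph k V] : Countable V :=
  Function.Injective.countable (f := (Mor.vertex : V → Mor V)) fun _ _ h => congrArg Mor.src h

/-! ### The Cuntz-Krieger relations for the operators `T_l` -/

namespace IsProjectiveSystem

variable {μ : Measure (InfPath V)} {f : Mor V → InfPath V → ℂ}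

theorem measure_cylinder_vertex_lt_top (hf : IsStandardProjectiveSystem μ f) (v : V) :
    μ (cylinder (Mor.vertex v)) < ∞ :=
  (hf.semibranching (Mor.vertex v).d).measure_dom_lt_top ⟨Mor.vertex v, rfl⟩

/-- The vertex cylinders are countably many, cover the path space and have finite measure. -/
theorem sigmaFinite (hf : IsStandardProjectiveSystem μ f) : SigmaFinite μ := by
  have := countable_vertices V
  refine Measure.sigmaFinite_of_countable (Set.countable_range fun v : V => cylinder (Mor.vertex v)) ?_ ?_
  · rintro _ ⟨v, rfl⟩
    exact hf.measure_cylinder_vertex_lt_top v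
  · refine Set.eq_univ_of_forall fun x => Set.mem_sUnion.2 ⟨_, ⟨x.range, rfl⟩, ?_⟩
    exact (mem_cylinder_vertex _ _).2 rfl

/-- The density `|f_l|²` is that of the image of `μ` under `σ_l`. This image has no mass off `Z(l)`,
so `f_l` vanishes there. Conversely, the zero set of `f_l` in `Z(l)` has null preimage under `σ_l`,
and `σ_l` maps null sets to null sets because `μ ∘ σ_l` has a density with respect to `μ`. -/
theorem ae_ne_zero_iff (hf : IsStandardProjectiveSystem μ f) (l : Mor V) :
    ∀ᵐ x ∂μ, f l x ≠ 0 ↔ x ∈ cylinder l := by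
  have hD : MeasurableSet (prefixDomain l) := measurableSet_cylinder _
  have hZ := measurableSet_cylinder l
  have hτ := hf.aemeasurable l
  have hfm := ((hf.memLp l).1.enorm.pow_const 2)
  have h1 : ∀ᵐ x ∂μ, x ∈ (cylinder l)ᶜ → f l x = 0 := by
    have h := congrArg (fun ν : Measure (InfPath V) => ν (cylinder l)ᶜ) (hf.map_eq l)
    rw [Measure.map_apply_of_aemeasurable hτ hZ.compl, withDensity_apply _ hZ.compl,
      Measure.restrict_apply' hD] at h
    have h0 : prefixMap l ⁻¹' (cylinder l)ᶜ ∩ prefixDomain l = ∅ := by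
      ext x
      simp only [Set.mem_inter_iff, Set.mem_preimage, Set.mem_compl_iff, Set.mem_empty_iff_false,
        iff_false, not_and]
      intro hx hxD
      exact hx (prefixMap_mem_cylinder hxD)
    rw [h0, measure_empty, eq_comm, lintegral_eq_zero_iff' hfm.restrict,
      Filter.EventuallyEq, ae_restrict_iff' hZ.compl] at h
    filter_upwards [h] with x hx hxZ
    simpa using hx hxZ
  -- A measurable representative makes the zero set `N` a Borel set.
  set f' := (hf.memLp l).1.mk (f l) with hf'
  have hff' : f l =ᵐ[μ] f' := (hf.memLp l).1.ae_eq_mk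
  have hf'm : Measurable f' := (hf.memLp l).1.stronglyMeasurable_mk.measurable
  set N : Set (InfPath V) := f' ⁻¹' {0} ∩ cylinder l with hN
  have hNm : MeasurableSet N := (hf'm (measurableSet_singleton 0)).inter hZ
  set B : Set (InfPath V) := prefixMap l ⁻¹' N ∩ prefixDomain l with hB
  have hBm : MeasurableSet B := by
    have := hD.subtype_image ((hf.semibranching l.d).measurable ⟨l, rfl⟩ hNm)
    convert this using 1
    ext x
    simp [hB, and_comm]
  have hB0 : μ B = 0 := by
    have h := congrArg (fun ν : Measure (InfPath V) => ν N) (hf.map_eq l)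
    rw [Measure.map_apply_of_aemeasurable hτ hNm, withDensity_apply _ hNm,
      Measure.restrict_apply' hD] at h
    rw [hB, h, lintegral_eq_zero_iff' hfm.restrict, Filter.EventuallyEq, ae_restrict_iff' hNm]
    filter_upwards [hff'] with x hx hxN
    have : f' x = 0 := hxN.1
    simp [hx, this]
  -- `B` is the `σ_l`-preimage of `N`. Every point of `N` lies in `Z(l)`, so it is `σ_l` of its
  -- shift and `N` is covered by the image of the null set `B`.
  have hN0 : μ N = 0 := by
    obtain ⟨Φ, -, hΦ, -⟩ := (hf.semibranching l.d).radonNikodym ⟨l, rfl⟩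
    have h := hΦ B Set.inter_subset_right hBm
    rw [Measure.restrict_eq_zero.2 hB0, lintegral_zero_measure] at h
    refine measure_mono_null (fun x hx => ?_) h
    have h2 := prefixMap_shift hx.2
    exact ⟨shift l.d x, ⟨by rw [Set.mem_preimage, h2]; exact hx, shift_mem_prefixDomain hx.2⟩, h2⟩
  filter_upwards [h1, hff', measure_eq_zero_iff_ae_notMem.1 hN0] with x h1 h2 h3
  refine ⟨fun h => by_contra fun hx => h (h1 hx), fun hx h => h3 ⟨?_, hx⟩⟩
  exact h2.symm.trans h

/-- Since `v v = v` and the shift by `0` is the identity, `f_v² = f_v` almost everywhere. So `f_v`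
is `1` wherever it is nonzero, that is, on `Z(v)`. -/
theorem T_vertex (hf : IsStandardProjectiveSystem μ f) (v : V) :
    hf.T (Mor.vertex v) =
      indicatorL2 μ (cylinder (Mor.vertex v)) (measurableSet_cylinder _) := by
  have h1 := hf.mul_comp (Mor.vertex v) (Mor.vertex v) rfl
  have h2 : (Mor.vertex v).comp (Mor.vertex v) rfl = Mor.vertex v := Mor.comp_vertex (Mor.vertex v)
  rw [h2] at h1
  ext1 ξ
  refine Lp.ext ?_
  filter_upwards [h1, hf.ae_ne_zero_iff (Mor.vertex v), hf.coeFn_T (Mor.vertex v) ξ,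
    coeFn_indicatorL2 (cylinder (Mor.vertex v)) (measurableSet_cylinder _) ξ] with x h1 h2 h3 h4
  rw [h3, h4]
  rw [Mor.d_vertex, shift_zero] at *
  by_cases hx : x ∈ cylinder (Mor.vertex v)
  · have h5 := h2.2 hx
    have h6 : f (Mor.vertex v) x = 1 := mul_left_cancel₀ h5 (h1.trans (mul_one _).symm)
    rw [h6, one_mul, Set.indicator_of_mem hx]
  · have h6 : f (Mor.vertex v) x = 0 := not_not.1 fun h => hx (h2.1 h)
    rw [h6, zero_mul, Set.indicator_of_notMem hx]

theorem T_mul_T (hf : IsStandardProjectiveSystem μ f) (a b : Mor V) (h : a.src = b.rng) :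
    hf.T a * hf.T b = hf.T (a.comp b h) := by
  ext1 ξ
  refine Lp.ext ?_
  filter_upwards [hf.coeFn_T a (hf.T b ξ), hf.comp_ae_eq a (hf.coeFn_T b ξ),
    hf.coeFn_T (a.comp b h) ξ, hf.mul_comp a b h] with x h1 h2 h3 h4
  rw [mul_apply_eq_comp, h1, h2, h3, ← h4, hf.coding_add, Mor.d_comp, add_comm b.d, mul_assoc]

/-- This is the change of variables `lintegral_eq` applied to `|ξ|²`. It says that `T_l` is a
partial isometry with initial space `L²(Z(s(l)))`. -/
theorem norm_T_apply (hf : IsStandardProjectiveSystem μ f) (l : Mor V) (ξ : Lp ℂ 2 μ) :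
    ‖hf.T l ξ‖ = ‖indicatorL2 μ (prefixDomain l) (measurableSet_prefixDomain l) ξ‖ := by
  have hD : MeasurableSet (prefixDomain l) := measurableSet_cylinder _
  have key : ∀ g : InfPath V → ℂ, eLpNorm g 2 μ = (∫⁻ x, ‖g x‖ₑ ^ 2 ∂μ) ^ (1 / 2 : ℝ) := by
    intro g
    rw [eLpNorm_eq_lintegral_rpow_enorm_toReal (by norm_num) (by norm_num)]
    simp
  have h1 := hf.lintegral_eq l (g := fun x => ‖ξ x‖ₑ ^ 2)
    ((Lp.stronglyMeasurable ξ).measurable.enorm.pow_const 2)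
  rw [Lp.norm_def, Lp.norm_def, eLpNorm_congr_ae (hf.coeFn_T l ξ),
    eLpNorm_congr_ae (coeFn_indicatorL2 _ hD ξ), key, key]
  simp only [enorm_mul, mul_pow]
  rw [h1, ← lintegral_indicator hD]
  congr 3
  ext x
  by_cases hx : x ∈ prefixDomain l <;> simp [hx]

theorem star_T_mul_T (hf : IsStandardProjectiveSystem μ f) (l : Mor V) :
    star (hf.T l) * hf.T l = indicatorL2 μ (prefixDomain l) (measurableSet_prefixDomain l) := by
  set M := indicatorL2 μ (prefixDomain l) (measurableSet_prefixDomain l) with hM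
  have hMM : M * M = M := (isStarProjection_indicatorL2 _ _).isIdempotentElem
  have hMs : star M = M := star_indicatorL2 _ _
  apply ContinuousLinearMap.coe_injective
  -- On a complex Hilbert space an operator is determined by its quadratic form, so the norm
  -- identity suffices.
  rw [← ext_inner_map]
  intro ξ
  have h1 : inner ℂ ((star (hf.T l) * hf.T l) ξ) ξ = inner ℂ (hf.T l ξ) (hf.T l ξ) := by
    rw [mul_apply_eq_comp, ContinuousLinearMap.star_eq_adjoint,
      ContinuousLinearMap.adjoint_inner_left]
  have h2 : inner ℂ (M ξ) ξ = inner ℂ (M ξ) (M ξ) := by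
    conv_lhs => rw [← hMM, ← hMs]
    rw [hMs]
    nth_rw 1 [← hMs]
    rw [mul_apply_eq_comp, ContinuousLinearMap.star_eq_adjoint,
      ContinuousLinearMap.adjoint_inner_left]
  refine h1.trans (Eq.trans ?_ h2.symm)
  rw [inner_self_eq_norm_sq_to_K, inner_self_eq_norm_sq_to_K, hf.norm_T_apply]

theorem T_mul_indicatorL2 (hf : IsStandardProjectiveSystem μ f) (l : Mor V) :
    hf.T l * indicatorL2 μ (prefixDomain l) (measurableSet_prefixDomain l) = hf.T l := by
  ext1 ξ
  set M := indicatorL2 μ (prefixDomain l) (measurableSet_prefixDomain l) with hM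
  have hMM : M * M = M := (isStarProjection_indicatorL2 _ _).isIdempotentElem
  rw [mul_apply_eq_comp, ← sub_eq_zero, ← map_sub, ← norm_eq_zero, hf.norm_T_apply, ← hM, map_sub,
    ← mul_apply_eq_comp, hMM, sub_self, norm_zero]

theorem indicatorL2_mul_T (hf : IsStandardProjectiveSystem μ f) (l : Mor V) :
    indicatorL2 μ (cylinder l) (measurableSet_cylinder _) * hf.T l = hf.T l := by
  ext1 ξ
  refine Lp.ext ?_
  filter_upwards [coeFn_indicatorL2 (cylinder l) (measurableSet_cylinder _) (hf.T l ξ),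
    hf.coeFn_T l ξ, hf.ae_ne_zero_iff l] with x h1 h2 h3
  rw [mul_apply_eq_comp, h1]
  by_cases hx : x ∈ cylinder l
  · rw [Set.indicator_of_mem hx]
  · have h6 : f l x = 0 := not_not.1 fun h => hx (h3.1 h)
    rw [Set.indicator_of_notMem hx, h2, h6, zero_mul]

/-- The range of `T_l` contains `L²(Z(l), μ)`. -/
theorem exists_T_eq (hf : IsStandardProjectiveSystem μ f) (l : Mor V) (η : Lp ℂ 2 μ) :
    ∃ ξ, hf.T l ξ = indicatorL2 μ (cylinder l) (measurableSet_cylinder _) η := by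
  have hD : MeasurableSet (prefixDomain l) := measurableSet_cylinder _
  set f' := (hf.memLp l).1.mk (f l) with hf'
  have hff' : f l =ᵐ[μ] f' := (hf.memLp l).1.ae_eq_mk
  have hf'm : Measurable f' := (hf.memLp l).1.stronglyMeasurable_mk.measurable
  have hηm : Measurable η := (Lp.stronglyMeasurable η).measurable
  -- Solving `f_l · (ξ ∘ σ^{d(l)}) = η` on `Z(l)` forces `ξ(x) = η(l x) / f_l(l x)` for `x` in
  -- `Z(s(l))`.
  set q : InfPath V → ℂ := fun x => η x / f' x with hq
  have hqm : Measurable q := hηm.div hf'm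
  have hm : MemLp ((prefixDomain l).indicator fun x => q (prefixMap l x)) 2 μ := by
    refine ⟨((aemeasurable_indicator_iff hD).2
      (hqm.comp_aemeasurable (hf.aemeasurable l))).aestronglyMeasurable, ?_⟩
    rw [eLpNorm_indicator_eq_eLpNorm_restrict hD,
      eLpNorm_lt_top_iff_lintegral_rpow_enorm_lt_top (by norm_num) (by norm_num)]
    have h2 : ((2 : ℝ≥0∞).toReal) = ((2 : ℕ) : ℝ) := by norm_num
    have hη := (eLpNorm_lt_top_iff_lintegral_rpow_enorm_lt_top (by norm_num) (by norm_num)).1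
      (Lp.eLpNorm_lt_top η)
    simp only [h2, ENNReal.rpow_natCast] at hη ⊢
    have hq2 : Measurable fun x => ‖q x‖ₑ ^ 2 := hqm.enorm.pow_const 2
    rw [← lintegral_map' (f := fun x => ‖q x‖ₑ ^ 2) hq2.aemeasurable (hf.aemeasurable l),
      hf.map_eq l, lintegral_withDensity_eq_lintegral_mul₀'
      ((hf.memLp l).1.enorm.pow_const 2) hq2.aemeasurable]
    -- The density `|f_l|²` cancels the denominator of `q`. Where `f'` vanishes the product is `0`,
    -- so only an inequality is claimed.
    refine lt_of_le_of_lt (lintegral_mono_ae ?_) hη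
    filter_upwards [hff'] with x hx
    rw [Pi.mul_apply, ← mul_pow, ← enorm_mul, hx, hq]
    gcongr
    by_cases h0 : f' x = 0
    · simp [h0]
    · rw [mul_div_cancel₀ _ h0]
  refine ⟨hm.toLp _, Lp.ext ?_⟩
  filter_upwards [hf.coeFn_T l (hm.toLp _), hf.comp_ae_eq l hm.coeFn_toLp, hff',
    coeFn_indicatorL2 (cylinder l) (measurableSet_cylinder _) η, hf.ae_ne_zero_iff l]
    with x h1 h2 h3 h4 h5
  rw [h1, h2, h4]
  by_cases hx : x ∈ cylinder l
  · have h6 := h5.2 hx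
    rw [Set.indicator_of_mem hx, Set.indicator_of_mem (shift_mem_prefixDomain hx),
      prefixMap_shift hx, hq]
    simp only
    rw [← h3, mul_div_cancel₀ _ h6]
  · have h6 : f l x = 0 := not_not.1 fun h => hx (h5.1 h)
    rw [Set.indicator_of_notMem hx, h6, zero_mul]

/-- The adjoint ignores the part of `η` off `Z(l)`, because `T_l` takes values in `L²(Z(l))`. The
remaining part is some `T_l ξ` by `exists_T_eq`, and `T_l T_l* T_l = T_l`. -/
theorem T_mul_star_T (hf : IsStandardProjectiveSystem μ f) (l : Mor V) :
    hf.T l * star (hf.T l) = indicatorL2 μ (cylinder l) (measurableSet_cylinder _) := by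
  set M := indicatorL2 μ (cylinder l) (measurableSet_cylinder _) with hM
  have h1 : star (hf.T l) * M = star (hf.T l) := by
    conv_rhs => rw [← hf.indicatorL2_mul_T l, star_mul, star_indicatorL2]
  ext1 η
  obtain ⟨ξ, hξ⟩ := hf.exists_T_eq l η
  rw [← h1, mul_apply_eq_comp, mul_apply_eq_comp, hM, ← hξ, ← mul_apply_eq_comp (star _),
    hf.star_T_mul_T, ← mul_apply_eq_comp, hf.T_mul_indicatorL2]

/-- The operators `T_l` form a Cuntz-Krieger family. -/
theorem isCKFamily_T [RowFinite V] (hf : IsStandardProjectiveSystem μ f) : IsCKFamily hf.T where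
  partialIsometry l := by
    rw [mul_assoc, hf.star_T_mul_T, hf.T_mul_indicatorL2]
  isStarProjection v := by
    rw [hf.T_vertex]
    exact isStarProjection_indicatorL2 _ _
  orthogonal v w h := by
    rw [hf.T_vertex, hf.T_vertex, indicatorL2_mul, ← indicatorL2_empty]
    congr 1
    refine Set.disjoint_iff_inter_eq_empty.1 (disjoint_cylinder ?_ ?_)
    · rw [Mor.d_vertex, Mor.d_vertex]
    · exact fun e => h (congrArg Mor.src e)
  mul a b h := hf.T_mul_T a b h
  star_mul_self l := by
    rw [hf.star_T_mul_T, hf.T_vertex]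
    rfl
  sum_mul_star v n := by
    rw [hf.T_vertex]
    simp only [hf.T_mul_star_T]
    refine sum_indicatorL2 _ cylinder measurableSet_cylinder ?_ _ _
      (cylinder_vertex_eq_biUnion v n)
    intro a ha b hb hab
    have ha' := (Set.Finite.mem_toFinset _).1 (Finset.mem_coe.1 ha)
    have hb' := (Set.Finite.mem_toFinset _).1 (Finset.mem_coe.1 hb)
    exact disjoint_cylinder (ha'.2.trans hb'.2.symm) hab

/-! ### Shift-invariant sets and commutation with the `T_l` -/

/-- If `A` is a.e. invariant under the shifts, then multiplication by `1_A` commutes with `T_l`. -/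
theorem indicatorL2_commute_T (hf : IsStandardProjectiveSystem μ f) {A : Set (InfPath V)}
    (hA : MeasurableSet A) (h : ∀ n : Fin k → ℕ, μ (A ∆ (shift n ⁻¹' A)) = 0) (l : Mor V) :
    indicatorL2 μ A hA * hf.T l = hf.T l * indicatorL2 μ A hA := by
  ext1 ξ
  refine Lp.ext ?_
  filter_upwards [coeFn_indicatorL2 A hA (hf.T l ξ), hf.coeFn_T l ξ,
    hf.coeFn_T l (indicatorL2 μ A hA ξ), hf.comp_ae_eq l (coeFn_indicatorL2 A hA ξ),
    measure_symmDiff_eq_zero_iff.1 (h l.d)] with x h1 h2 h3 h4 h5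
  have h6 : x ∈ A ↔ shift l.d x ∈ A := iff_of_eq h5
  rw [mul_apply_eq_comp, mul_apply_eq_comp, h1, h3, h4]
  by_cases hx : x ∈ A
  · rw [Set.indicator_of_mem hx, Set.indicator_of_mem (h6.1 hx), h2]
  · rw [Set.indicator_of_notMem hx, Set.indicator_of_notMem (mt h6.2 hx), mul_zero]

/-- If multiplication by `1_A` commutes with all the `T_l`, then `A` is a.e. invariant under the
shifts. -/
theorem measure_symmDiff_shift_of_commute (hf : IsStandardProjectiveSystem μ f)
    {A : Set (InfPath V)} (hA : MeasurableSet A)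
    (h : ∀ l, indicatorL2 μ A hA * hf.T l = hf.T l * indicatorL2 μ A hA) (n : Fin k → ℕ) :
    μ (A ∆ (shift n ⁻¹' A)) = 0 := by
  have := hf.sigmaFinite
  -- On `Z(l)` the function `T_l g` vanishes almost nowhere, so applying the commutation relation to
  -- `g` alone compares `1_A` with `1_A ∘ σ^{d(l)}` there.
  obtain ⟨g, hgm, hg⟩ := exists_memLp_two_forall_ne_zero μ
  have key : ∀ l : Mor V, ∀ᵐ x ∂μ, x ∈ cylinder l → (x ∈ A ↔ shift l.d x ∈ A) := by
    intro l
    have h0 := congrArg (fun S : Lp ℂ 2 μ →L[ℂ] Lp ℂ 2 μ => S (hgm.toLp g)) (h l)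
    simp only [mul_apply_eq_comp] at h0
    have h1 := coeFn_indicatorL2 A hA (hf.T l (hgm.toLp g))
    rw [h0] at h1
    filter_upwards [h1, hf.coeFn_T l (hgm.toLp g), hf.comp_ae_eq l hgm.coeFn_toLp,
      hf.coeFn_T l (indicatorL2 μ A hA (hgm.toLp g)),
      hf.comp_ae_eq l ((coeFn_indicatorL2 A hA (hgm.toLp g)).trans
        (hgm.coeFn_toLp.indicator (s := A))), hf.ae_ne_zero_iff l]
      with x h1 h2 h3 h4 h5 h6 hx
    have h7 := h6.2 hx
    rw [h4, h5] at h1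
    have h8 : hf.T l (hgm.toLp g) x ≠ 0 := by
      rw [h2, h3]
      exact mul_ne_zero h7 (hg _)
    by_cases hxA : x ∈ A
    · rw [Set.indicator_of_mem hxA] at h1
      refine iff_of_true hxA (by_contra fun hs => h8 ?_)
      rw [← h1, Set.indicator_of_notMem hs, mul_zero]
    · rw [Set.indicator_of_notMem hxA] at h1
      refine iff_of_false hxA fun hs => ?_
      rw [Set.indicator_of_mem hs] at h1
      exact mul_ne_zero h7 (hg _) h1
  rw [measure_symmDiff_eq_zero_iff]
  -- Paths are countable, so one null set serves all `l`. Each `x` lies in the cylinder of its own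
  -- initial segment `x(0, n)`, which has degree `n`.
  filter_upwards [ae_all_iff.2 key] with x hx
  have h1 := hx _ (x.mem_cylinder_seg n)
  rw [d_seg, tsub_zero] at h1
  exact propext h1

end IsProjectiveSystem

/-! ### Restricting representations and passing from generators to `C*(Λ)` -/

section Restriction

variable {A H : Type*} [NonUnitalNonAssocSemiring A] [Star A] [Module ℂ A]
  [NormedAddCommGroup H] [InnerProductSpace ℂ H] [CompleteSpace H]

/-- The restriction of a representation to a closed invariant subspace. -/
def restrictRep (π : A →⋆ₙₐ[ℂ] (H →L[ℂ] H)) (W : Submodule ℂ H) [CompleteSpace W]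
    (hW : ∀ a, ∀ ξ ∈ W, π a ξ ∈ W) : A →⋆ₙₐ[ℂ] (W →L[ℂ] W) where
  toFun a := ((π a).comp W.subtypeL).codRestrict W fun ξ => hW a ξ ξ.2
  map_smul' c a := by
    ext ξ
    change π (c • a) ξ = c • π a ξ
    rw [map_smul]
    rfl
  map_zero' := by
    ext ξ
    change π 0 ξ = 0
    rw [map_zero]
    rfl
  map_add' a b := by
    ext ξ
    change π (a + b) ξ = π a ξ + π b ξ
    rw [map_add]
    rfl
  map_mul' a b := by
    ext ξ
    change π (a * b) ξ = π a (π b ξ)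
    rw [map_mul]
    rfl
  map_star' a := by
    rw [ContinuousLinearMap.star_eq_adjoint, ContinuousLinearMap.eq_adjoint_iff]
    intro ξ η
    change inner ℂ (π (star a) ξ) (η : H) = inner ℂ (ξ : H) (π a η)
    rw [map_star, ContinuousLinearMap.star_eq_adjoint, ContinuousLinearMap.adjoint_inner_left]

end Restriction

/-- Conjugation of a representation by a self-adjoint unitary. -/
def conjRep {A B : Type*} [NonUnitalNonAssocSemiring A] [Star A] [Module ℂ A] [Ring B] [StarRing B]
    [Algebra ℂ B] (π : A →⋆ₙₐ[ℂ] B) (U : B) (hs : star U = U) (hU : U * U = 1) :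
    A →⋆ₙₐ[ℂ] B where
  toFun a := U * π a * U
  map_smul' c a := by simp
  map_zero' := by simp
  map_add' a b := by simp [mul_add, add_mul]
  map_mul' a b := by
    have : U * π a * U * (U * π b * U) = U * π a * (U * U) * π b * U := by noncomm_ring
    rw [this, hU, map_mul]
    noncomm_ring
  map_star' a := by
    rw [star_mul, star_mul, hs, map_star, mul_assoc]

/-- A projection that commutes with the images of the generators commutes with the image of
`C*(Λ)`. -/
theorem KGraphCStar.commute_of_commute_gen [RowFinite V] {B : Type*} [CStarAlgebra B]
    (π : KGraphCStar V →⋆ₙₐ[ℂ] B) (p : B) (hp : IsStarProjection p)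
    (h : ∀ l, p * π (gen l) = π (gen l) * p) (a : KGraphCStar V) : p * π a = π a * p := by
  have hpp : p * p = p := hp.isIdempotentElem
  -- The symmetry `2p - 1` is a self-adjoint unitary with the same commutant as `p`. Conjugating `π`
  -- by it gives a `*`-homomorphism that agrees with `π` on generators, hence everywhere. This
  -- carries commutation with `p` from the generators to the whole algebra.
  set U : B := p + p - 1 with hUdef
  have hs : star U = U := by
    rw [hUdef, star_sub, star_add, hp.isSelfAdjoint.star_eq, star_one]
  have hU : U * U = 1 := by
    have : U * U = 4 * (p * p) - 4 * p + 1 := by rw [hUdef]; noncomm_ring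
    rw [this, hpp, sub_self, zero_add]
  have hconj : conjRep π U hs hU = π := by
    refine KGraphCStar.hom_ext fun l => ?_
    change U * π (gen l) * U = π (gen l)
    have hc : U * π (gen l) = π (gen l) * U := by
      rw [hUdef, sub_mul, add_mul, h l, mul_sub, mul_add, one_mul, mul_one]
    rw [hc, mul_assoc, hU, mul_one]
  have h1 : U * π a * U = π a := DFunLike.congr_fun hconj a
  have h2 : U * π a = π a * U := by
    conv_rhs => rw [← h1]
    rw [mul_assoc _ U U, hU, mul_one]
  rw [hUdef, sub_mul, add_mul, mul_sub, mul_add, one_mul, mul_one, sub_left_inj, ← two_smul ℂ,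
    ← two_smul ℂ (π a * p)] at h2
  exact smul_right_injective B (two_ne_zero (α := ℂ)) h2

/-! ### Closed subspaces invariant under the `T_l` and their adjoints -/

namespace IsProjectiveSystem

open InfPath

variable {μ : Measure (InfPath V)} {f : Mor V → InfPath V → ℂ}

/-- A closed subspace of `L²(Λ^∞, μ)` that is invariant under the operators `T_l` and their adjoints
is `L²(A, μ)` for a set `A` that is a.e. invariant under the shifts. -/
theorem exists_eq_L2On_of_invariant (hf : IsStandardProjectiveSystem μ f)
    (K : Submodule ℂ (Lp ℂ 2 μ)) (hK : IsClosed (K : Set (Lp ℂ 2 μ)))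
    (hT : ∀ l, ∀ ξ ∈ K, hf.T l ξ ∈ K) (hT' : ∀ l, ∀ ξ ∈ K, star (hf.T l) ξ ∈ K) :
    ∃ A, MeasurableSet A ∧ (∀ n : Fin k → ℕ, μ (A ∆ (shift n ⁻¹' A)) = 0) ∧ K = L2On μ A := by
  have := hf.sigmaFinite
  have hind := indicatorL2_mem_of_generateFrom K hK _ measurableSpace_eq_generateFrom
    (by
      rintro _ ⟨l, rfl⟩ hB ξ hξ
      rw [← hf.T_mul_star_T l, mul_apply_eq_comp]
      exact hT l _ (hT' l _ hξ))
  obtain ⟨A, hA, rfl⟩ := exists_eq_L2On K hK hind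
  refine ⟨A, hA, hf.measure_symmDiff_shift_of_commute hA fun l => ?_, rfl⟩
  -- With `M` the projection onto `L²(A)`, invariance under `T` reads `M T M = T M`. Invariance
  -- under `T*` reads `M T* M = T* M`, whose adjoint is `M T M = M T`. Hence `M T = T M`.
  have h1 : indicatorL2 μ A hA * (hf.T l * indicatorL2 μ A hA) = hf.T l * indicatorL2 μ A hA := by
    ext1 ξ
    exact (mem_L2On_iff A hA _).1 (hT l _ (indicatorL2_mem_L2On A hA ξ))
  have h2 : indicatorL2 μ A hA * (star (hf.T l) * indicatorL2 μ A hA) =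
      star (hf.T l) * indicatorL2 μ A hA := by
    ext1 ξ
    exact (mem_L2On_iff A hA _).1 (hT' l _ (indicatorL2_mem_L2On A hA ξ))
  have h3 := congrArg star h2
  simp only [star_mul, star_star, star_indicatorL2] at h3
  rw [← h3, mul_assoc, h1]

end IsProjectiveSystem

end

end HigherRank

/-! ### The representation and its irreducibility on `L²(E)` -/

open HigherRank MeasureTheory in
theorem mainTheorem4 {k : ℕ} (hk : 1 ≤ k) (V : Type u) [CategoryTheory.SmallCategory V]
    [HigherRank.KGraph k V] [HigherRank.RowFinite V]
    (hsource : HigherRank.NoSources V) (hsink : HigherRank.NoSinks V)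
    (μ : MeasureTheory.Measure (HigherRank.InfPath V)) [μ.Regular]
    (f : HigherRank.Mor V → HigherRank.InfPath V → ℂ)
    (hf : HigherRank.IsStandardProjectiveSystem μ f)
    (E : Set (HigherRank.InfPath V)) (hE : HigherRank.IsMinimalMuInvariant μ E) :
    ∃ π : HigherRank.KGraphCStar V →⋆ₙₐ[ℂ]
        (MeasureTheory.Lp ℂ 2 μ →L[ℂ] MeasureTheory.Lp ℂ 2 μ),
      (∀ l, π (HigherRank.KGraphCStar.gen l) = hf.T l) ∧
      (∀ a, ∀ ξ ∈ HigherRank.L2On μ E, π a ξ ∈ HigherRank.L2On μ E) ∧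
      ∃ ρ : HigherRank.KGraphCStar V →⋆ₙₐ[ℂ]
          (HigherRank.L2On μ E →L[ℂ] HigherRank.L2On μ E),
        (∀ a ξ, (ρ a ξ : MeasureTheory.Lp ℂ 2 μ) = π a ξ) ∧
        HigherRank.IsIrreducibleRep ρ := by
  obtain ⟨⟨hEm, hE0, hEinv⟩, hmin⟩ := hE
  obtain ⟨π, hπ, -⟩ := KGraphCStar.existsUnique_hom hf.isCKFamily_T
  have hW : ∀ a, ∀ ξ ∈ L2On μ E, π a ξ ∈ L2On μ E := by
    intro a ξ hξ
    have hc := KGraphCStar.commute_of_commute_gen π (indicatorL2 μ E hEm)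
      (isStarProjection_indicatorL2 E hEm)
      (fun l => by rw [hπ]; exact hf.indicatorL2_commute_T hEm hEinv l) a
    have h1 := congrArg (fun S : Lp ℂ 2 μ →L[ℂ] Lp ℂ 2 μ => S ξ) hc
    simp only [mul_apply_eq_comp] at h1
    rw [(mem_L2On_iff E hEm ξ).1 hξ] at h1
    exact (mem_L2On_iff E hEm _).2 h1
  refine ⟨π, hπ, hW, restrictRep π _ hW, fun a ξ => rfl, ?_, ?_⟩
  -- If the restriction were zero, each vertex projection, which is multiplication by `1_{Z(v)}`,
  -- would kill `1_{Z(v) ∩ E}`. So every `Z(v) ∩ E` would be null, and countably many of these sets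
  -- cover `E`.
  · by_contra! hzero
    have := countable_vertices V
    have hv : ∀ v : V, ∀ᵐ x ∂μ, x ∈ InfPath.cylinder (Mor.vertex v) → x ∉ E := by
      intro v
      have hZ := InfPath.measurableSet_cylinder (Mor.vertex v)
      have hfin : μ (InfPath.cylinder (Mor.vertex v) ∩ E) ≠ ⊤ :=
        ((measure_mono Set.inter_subset_left).trans_lt (hf.measure_cylinder_vertex_lt_top v)).ne
      set ξ : Lp ℂ 2 μ := indicatorConstLp 2 (hZ.inter hEm) hfin (1 : ℂ) with hξ
      have hcoe : ξ =ᵐ[μ] (InfPath.cylinder (Mor.vertex v) ∩ E).indicator fun _ => (1 : ℂ) :=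
        indicatorConstLp_coeFn
      have hξE : ξ ∈ L2On μ E := by
        filter_upwards [hcoe] with x hx hxE
        rw [hx, Set.indicator_of_notMem fun h => hxE h.2]
      have h1 : π (KGraphCStar.gen (Mor.vertex v)) ξ = 0 := by
        have h2 := DFunLike.congr_fun (hzero (KGraphCStar.gen (Mor.vertex v)))
          (⟨ξ, hξE⟩ : L2On μ E)
        exact congrArg Subtype.val h2
      rw [hπ, hf.T_vertex] at h1
      have h3 := coeFn_indicatorL2 _ hZ ξ
      rw [h1] at h3
      filter_upwards [h3, hcoe, Lp.coeFn_zero ℂ 2 μ] with x h3 h4 h5 hx hxE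
      have hxZE : x ∈ InfPath.cylinder (Mor.vertex v) ∩ E := ⟨hx, hxE⟩
      rw [h5, Set.indicator_of_mem hx, h4, Set.indicator_of_mem hxZE] at h3
      exact zero_ne_one h3
    refine hE0 (measure_eq_zero_iff_ae_notMem.2 ?_)
    filter_upwards [ae_all_iff.2 hv] with x hx
    exact hx x.range ((InfPath.mem_cylinder_vertex _ _).2 rfl)
  · intro K hK hinv
    -- `K` is viewed inside the full space, where it is still closed because `L²(E)` is closed.
    set K' : Submodule ℂ (Lp ℂ 2 μ) := K.map (L2On μ E).subtype with hK'
    have hcl : IsClosed (K' : Set (Lp ℂ 2 μ)) := by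
      rw [hK', Submodule.map_coe]
      exact (isClosed_L2On μ E).isClosedEmbedding_subtypeVal.isClosedMap _ hK
    have hinv' : ∀ a, ∀ ξ ∈ K', π a ξ ∈ K' := by
      rintro a _ ⟨ξ, hξ, rfl⟩
      exact ⟨_, hinv a ξ hξ, rfl⟩
    have hle : K' ≤ L2On μ E := Submodule.map_subtype_le _ _
    obtain ⟨A, hA, hAinv, hKA⟩ := hf.exists_eq_L2On_of_invariant K' hcl
      (fun l ξ hξ => by rw [← hπ]; exact hinv' _ ξ hξ)
      (fun l ξ hξ => by rw [← hπ, ← map_star]; exact hinv' _ ξ hξ)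
    -- `A` is determined only up to null sets, whereas minimality speaks of genuine subsets of `E`.
    -- Hence `A` is replaced by `A ∩ E`.
    have hAE : L2On μ (A ∩ E) = K' := by
      refine le_antisymm ?_ fun ξ hξ => ?_
      · rw [hKA]
        intro ξ hξ
        change ∀ᵐ x ∂μ, x ∉ A → ξ x = 0
        filter_upwards [hξ] with x hx hxA
        exact hx fun h => hxA h.1
      · have h1 := hle hξ
        rw [hKA] at hξ
        change ∀ᵐ x ∂μ, x ∉ A ∩ E → ξ x = 0
        filter_upwards [h1, hξ] with x h1 h2 h3
        by_cases hxA : x ∈ A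
        · exact h1 fun hxE => h3 ⟨hxA, hxE⟩
        · exact h2 hxA
    have hmap : ∀ L : Submodule ℂ (L2On μ E), K' = L.map (L2On μ E).subtype → K = L :=
      fun L hL => Submodule.map_injective_of_injective (L2On μ E).injective_subtype hL
    by_cases h0 : μ (A ∩ E) = 0
    · refine Or.inl (hmap _ ?_)
      rw [← hAE, L2On_eq_bot h0, Submodule.map_bot]
    · refine Or.inr (hmap _ ?_)
      -- `A ∩ E` has nonzero measure and inherits almost everywhere shift-invariance from `A` and
      -- `E`, so minimality of `E` applies.
      have h1 : μ (symmDiff (A ∩ E) E) = 0 := by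
        by_contra hne
        refine hmin ⟨A ∩ E, Set.inter_subset_right, ⟨hA.inter hEm, h0, fun n => ?_⟩, hne⟩
        exact measure_symmDiff_eq_zero_iff.2
          ((measure_symmDiff_eq_zero_iff.1 (hAinv n)).inter
            (measure_symmDiff_eq_zero_iff.1 (hEinv n)))
      rw [← hAE, L2On_congr (measure_symmDiff_eq_zero_iff.1 h1), Submodule.map_subtype_top]
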